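/- Let $A$ be a finite-dimensional algebra over a field, let $\mathscr{A}=A\text{-mod}$ be the category of finitely generated left $A$-modules, and let $\mathscr{C}$ be a full additive subcategory of $\mathscr{A}$, closed under direct summands, which is contravariantly finite (every $D\in\mathscr{A}$ has a right $\mathscr{C}$-approximation, i.e. a morphism $C\to D$ with $C\in\mathscr{C}$ through which every morphism from an object of $\mathscr{C}$ to $D$ factors) and admissible (every right $\mathscr{C}$-approximation is epic). A complex $X$ is $\mathscr{C}$-acyclic (or $\mathrm{Hom}_{\mathscr{A}}(\mathscr{C},-)$-exact) if $\mathrm{Hom}_{\mathscr{A}}(C,X)$ is acyclic for all $C\in\mathscr{C}$, and $\mathrm{Hom}_{\mathscr{A}}(-,\mathscr{C})$-exact if $\mathrm{Hom}_{\mathscr{A}}(X,C)$ is acyclic for all $C\in\mathscr{C}$. Let $D^b_{\mathscr{C}}(\mathscr{A})=K^b(\mathscr{A})/K^b_{\mathscr{C}\text{-ac}}(\mathscr{A})$ be the Verdier quotient of the bounded homotopy category by the $\mathscr{C}$-acyclic complexes, and let $D_{\mathscr{C}\text{-sg}}(\mathscr{A})=D^b_{\mathscr{C}}(\mathscr{A})/K^b(\mathscr{C})$.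 Modules are viewed as complexes concentrated in degree $0$; this gives the canonical functor $\mathscr{A}\to K^b(\mathscr{A})\to D^b_{\mathscr{C}}(\mathscr{A})\to D_{\mathscr{C}\text{-sg}}(\mathscr{A})$. For $M\in\mathscr{A}$ let $C_M\to M$ be a left $\mathscr{C}$-resolution, i.e. a morphism of complexes with $C_M^n\in\mathscr{C}$ for all $n$ and $C_M^n=0$ for $n>0$ which becomes a quasi-isomorphism after applying $\mathrm{Hom}_{\mathscr{A}}(C,-)$ for every $C\in\mathscr{C}$; put $\mathrm{Ext}^n_{\mathscr{C}}(M,N)=H^n\mathrm{Hom}_{\mathscr{A}}(C_M,N)$, and let ${}^{\perp_{\mathscr{C}}}\mathscr{C}$ be the class of all $M$ with $\mathrm{Ext}^i_{\mathscr{C}}(M,C)=0$ for all $C\in\mathscr{C}$ and $i\ge 1$. Let $\mathscr{C}(M,N)\subseteq\mathrm{Hom}_{\mathscr{A}}(M,N)$ be the subgroup of the morphisms that factor through an object of $\mathscr{C}$. Let $\mathscr{G}(\mathscr{C})$ be the full subcategory of the modules isomorphic to $\mathrm{Im}(C^{-1}\to C^0)$ for some acyclic complex $\cdots\to C^{-1}\to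 C^0\to C^1\to\cdots$ with terms in $\mathscr{C}$ that is both $\mathrm{Hom}_{\mathscr{A}}(\mathscr{C},-)$-exact and $\mathrm{Hom}_{\mathscr{A}}(-,\mathscr{C})$-exact. With the $\mathrm{Hom}_{\mathscr{A}}(\mathscr{C},-)$-exact complexes $0\to L\to M\to N\to 0$ with $L,M,N\in\mathscr{G}(\mathscr{C})$ as short exact sequences, $\mathscr{G}(\mathscr{C})$ is a Frobenius category; its stable category $\underline{\mathscr{G}(\mathscr{C})}$ has the same objects, and its morphisms are those of $\mathscr{G}(\mathscr{C})$ modulo the ones that factor through a projective-injective object. Let $\theta:\mathscr{G}(\mathscr{C})\to D_{\mathscr{C}\text{-sg}}(\mathscr{A})$ be the restriction of the canonical functor. (1) For all $M\in{}^{\perp_{\mathscr{C}}}\mathscr{C}$ and $N\in\mathscr{A}$, the canonical functor induces an isomorphism of abelian groups $$\mathrm{Hom}_{\mathscr{A}}(M,N)/\mathscr{C}(M,N)\;\cong\;\mathrm{Hom}_{D_{\mathscr{C}\text{-sg}}(\mathscr{A})}(M,N).$$ (2) The functor $\theta$ induces a fully faithful functor $\theta':\underline{\mathscr{G}(\mathscr{C})}\to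 D_{\mathscr{C}\text{-sg}}(\mathscr{A})$, i.e. $\theta$ is the composition of the quotient functor $\mathscr{G}(\mathscr{C})\to\underline{\mathscr{G}(\mathscr{C})}$ with $\theta'$. -/

import Mathlib

open CategoryTheory Limits Opposite Pretriangulated ZeroObject

universe w v u

noncomputable section

namespace RelSing

variable {𝒜 : Type u} [Category.{v} 𝒜] [Abelian 𝒜]

section Subcategories

variable (C : ObjectProperty 𝒜)

/-- A right `C`-approximation of `D`: a morphism `f : X ⟶ D` with `X` in `C` through which every
morphism from an object of `C` to `D` factors. -/
def IsRightApproximation {X D : 𝒜} (f : X ⟶ D) : Prop :=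
  C X ∧ ∀ ⦃X' : 𝒜⦄ (g : X' ⟶ D), C X' → ∃ h : X' ⟶ X, h ≫ f = g

/-- `C` is contravariantly finite in `𝒜`: every object has a right `C`-approximation. -/
def IsContravariantlyFinite : Prop :=
  ∀ D : 𝒜, ∃ (X : 𝒜) (f : X ⟶ D), IsRightApproximation C f

/-- `C` is admissible: it is contravariantly finite and every right `C`-approximation is epic. -/
structure IsAdmissible : Prop where
  contravariantlyFinite : IsContravariantlyFinite C
  epi_of_isRightApproximation : ∀ ⦃X D : 𝒜⦄ (f : X ⟶ D), IsRightApproximation C f → Epi f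

/-- The complex of abelian groups `Hom_𝒜(c, K)`, with `Hom_𝒜(c, K ^ n)` in degree `n`. -/
abbrev homFrom (c : 𝒜) (K : CochainComplex 𝒜 ℤ) : CochainComplex AddCommGrpCat.{v} ℤ :=
  ((preadditiveCoyoneda.obj (op c)).mapHomologicalComplex (.up ℤ)).obj K

/-- The complex of abelian groups `Hom_𝒜(K, c)`. The group at the index `n` is `Hom_𝒜(K ^ n, c)`
and the differential goes from the index `n + 1` to the index `n`, so that the cohomological
degree of the index `n` is `- n`. -/
abbrev homTo (K : CochainComplex 𝒜 ℤ) (c : 𝒜) :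
    HomologicalComplex AddCommGrpCat.{v} (ComplexShape.up ℤ).symm :=
  ((preadditiveYoneda.obj c).mapHomologicalComplex (ComplexShape.up ℤ).symm).obj K.op

/-- `K` is `C`-acyclic, i.e. `Hom_𝒜(C, -)`-exact. -/
def IsHomFromExact (K : CochainComplex 𝒜 ℤ) : Prop :=
  ∀ c : 𝒜, C c → (homFrom c K).Acyclic

/-- `K` is `Hom_𝒜(-, C)`-exact. -/
def IsHomToExact (K : CochainComplex 𝒜 ℤ) : Prop :=
  ∀ c : 𝒜, C c → (homTo K c).Acyclic

/-- `f` is a `C`-quasi-isomorphism. -/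
def IsRelQuasiIso {K L : CochainComplex 𝒜 ℤ} (f : K ⟶ L) : Prop :=
  ∀ c : 𝒜, C c →
    QuasiIso (((preadditiveCoyoneda.obj (op c)).mapHomologicalComplex (.up ℤ)).map f)

/-- A left `C`-resolution (`C`-proper `C`-resolution) of `M`. -/
structure LeftResolution (M : 𝒜) where
  /-- the resolving complex -/
  complex : CochainComplex 𝒜 ℤ
  mem : ∀ n : ℤ, C (complex.X n)
  isStrictlyLE : complex.IsStrictlyLE 0
  /-- the augmentation to `M`, seen as a complex concentrated in degree `0` -/
  π : complex ⟶ (CochainComplex.singleFunctor 𝒜 0).obj M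
  isRelQuasiIso : IsRelQuasiIso C π

variable {C} in
/-- The relative extension group `Ext_C^n(M, N) = H^n Hom_𝒜(C_M, N)`, computed with the left
`C`-resolution `R = C_M` of `M`. -/
def LeftResolution.extGroup {M : 𝒜} (R : LeftResolution C M) (n : ℤ) (N : 𝒜) : AddCommGrpCat.{v} :=
  (homTo R.complex N).homology (-n)

/-- The class of the objects `M` with `Ext_C^i(M, c) = 0` for all `c` in `C` and `i ≥ 1`.
(The relative extension groups do not depend on the choice of the left `C`-resolution.) -/
def leftPerp : ObjectProperty 𝒜 :=
  fun M ↦ ∃ R : LeftResolution C M, ∀ c : 𝒜, C c → ∀ i : ℤ, 1 ≤ i → IsZero (R.extGroup i c)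

/-- The Gorenstein category `𝒢(C)`. -/
def gorenstein : ObjectProperty 𝒜 :=
  fun M ↦ ∃ K : CochainComplex 𝒜 ℤ, (∀ n : ℤ, C (K.X n)) ∧ K.Acyclic ∧
    IsHomFromExact C K ∧ IsHomToExact C K ∧ Nonempty (M ≅ image (K.d (-1) 0))

/-- The class `ε` of conflations of `𝒢(C)`: the sequences `0 ⟶ L ⟶ M ⟶ N ⟶ 0` with terms in
`𝒢(C)` which become short exact after applying `Hom_𝒜(c, -)` for all `c` in `C`. -/
def IsConflation (S : ShortComplex (gorenstein C).FullSubcategory) : Prop :=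
  ∀ c : 𝒜, C c → ((S.map (gorenstein C).ι).map (preadditiveCoyoneda.obj (op c))).ShortExact

/-- The projective objects of the exact category `(𝒢(C), ε)`. -/
def IsConflationProjective (P : (gorenstein C).FullSubcategory) : Prop :=
  ∀ S : ShortComplex (gorenstein C).FullSubcategory, IsConflation C S →
    ∀ f : P ⟶ S.X₃, ∃ g : P ⟶ S.X₂, g ≫ S.g = f

/-- The injective objects of the exact category `(𝒢(C), ε)`. -/
def IsConflationInjective (I : (gorenstein C).FullSubcategory) : Prop :=
  ∀ S : ShortComplex (gorenstein C).FullSubcategory, IsConflation C S →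
    ∀ f : S.X₁ ⟶ I, ∃ g : S.X₂ ⟶ I, S.f ≫ g = f

/-- Two morphisms of `𝒢(C)` are identified in the stable category when their difference factors
through a projective-injective object of `(𝒢(C), ε)`. -/
def stableRel : HomRel (gorenstein C).FullSubcategory :=
  fun X Y f g ↦ ∃ (P : (gorenstein C).FullSubcategory) (a : X ⟶ P) (b : P ⟶ Y),
    IsConflationProjective C P ∧ IsConflationInjective C P ∧ f - g = a ≫ b

/-- The stable category of `𝒢(C)`. -/
abbrev StableGorenstein := CategoryTheory.Quotient (stableRel C)

/-- The canonical functor from `𝒢(C)` to its stable category. -/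
abbrev toStable : (gorenstein C).FullSubcategory ⥤ StableGorenstein C :=
  Quotient.functor (stableRel C)

lemma prop_biprod [C.IsClosedUnderFiniteProducts] {X Y : 𝒜} (hX : C X) (hY : C Y) :
    C (X ⊞ Y) :=
  C.prop_of_isLimit_binaryFan (BinaryBiproduct.isLimit X Y) hX hY

instance [C.IsClosedUnderFiniteProducts] : C.IsClosedUnderIsomorphisms :=
  ObjectProperty.IsClosedUnderBinaryProducts.closedUnderIsomorphisms C

instance [C.IsClosedUnderFiniteProducts] : C.ContainsZero :=
  ⟨_, (isZero_zero 𝒜).of_iso (HasZeroObject.zeroIsoTerminal).symm, C.prop_terminal⟩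

/-- The group `C(M, N)` of the morphisms `M ⟶ N` that factor through an object of `C`. -/
def factoring [C.IsClosedUnderFiniteProducts] (M N : 𝒜) : AddSubgroup (M ⟶ N) where
  carrier := { f | ∃ (c : 𝒜) (a : M ⟶ c) (b : c ⟶ N), C c ∧ a ≫ b = f }
  zero_mem' := by
    obtain ⟨Z, -, hZ⟩ := C.exists_prop_of_containsZero
    exact ⟨Z, 0, 0, hZ, by simp⟩
  add_mem' := by
    rintro _ _ ⟨c, a, b, hc, rfl⟩ ⟨c', a', b', hc', rfl⟩
    exact ⟨c ⊞ c', biprod.lift a a', biprod.desc b b', prop_biprod C hc hc', by simp⟩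
  neg_mem' := by
    rintro _ ⟨c, a, b, hc, rfl⟩
    exact ⟨c, a, -b, hc, by simp⟩

end Subcategories

section HomotopyCategories

variable (𝒜)

/-- The objects of the homotopy category `K(𝒜)` that are bounded complexes. -/
def bounded : ObjectProperty (HomotopyCategory 𝒜 (.up ℤ)) :=
  fun X ↦ ∃ a b : ℤ, CochainComplex.IsStrictlyGE X.as a ∧ CochainComplex.IsStrictlyLE X.as b

instance : (bounded 𝒜).ContainsZero where
  exists_zero :=
    ⟨(HomotopyCategory.quotient _ _).obj 0, Functor.map_isZero _ (isZero_zero _),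
      0, 0, inferInstanceAs (CochainComplex.IsStrictlyGE (0 : CochainComplex 𝒜 ℤ) 0),
      inferInstanceAs (CochainComplex.IsStrictlyLE (0 : CochainComplex 𝒜 ℤ) 0)⟩

instance : (bounded 𝒜).IsStableUnderShift ℤ where
  isStableUnderShiftBy n :=
    { le_shift X hX := by
        obtain ⟨K : CochainComplex 𝒜 ℤ, rfl⟩ := X.quotient_obj_surjective
        obtain ⟨a, b, (ha : K.IsStrictlyGE a), (hb : K.IsStrictlyLE b)⟩ := hX
        rw [ObjectProperty.prop_shift_iff, HomotopyCategory.shift_quotient_obj]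
        exact ⟨a - n, b - n, K.isStrictlyGE_shift a n (a - n) (by lia),
          K.isStrictlyLE_shift b n (b - n) (by lia)⟩ }

lemma exists_iso_mappingCone (T : Triangle (HomotopyCategory 𝒜 (.up ℤ)))
    (hT : T ∈ distTriang (HomotopyCategory 𝒜 (.up ℤ))) :
    ∃ f : T.obj₁.as ⟶ T.obj₂.as,
      Nonempty (T.obj₃ ≅ (HomotopyCategory.quotient 𝒜 (.up ℤ)).obj
        (CochainComplex.mappingCone f)) := by
  obtain ⟨f : T.obj₁.as ⟶ T.obj₂.as, hf⟩ :=
    (HomotopyCategory.quotient _ _).map_surjective T.mor₁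
  exact ⟨f, ⟨Triangle.π₃.mapIso (isoTriangleOfIso₁₂ T _ hT
    (HomotopyCategory.mappingCone_triangleh_distinguished f) (Iso.refl _) (Iso.refl _)
      ((Category.comp_id _).trans (hf.symm.trans (Category.id_comp _).symm)))⟩⟩

lemma bounded_mappingCone {K L : CochainComplex 𝒜 ℤ} (f : K ⟶ L) (a₁ a₂ b₁ b₂ : ℤ)
    [K.IsStrictlyGE a₁] [L.IsStrictlyGE a₂] [K.IsStrictlyLE b₁] [L.IsStrictlyLE b₂] :
    bounded 𝒜 ((HomotopyCategory.quotient 𝒜 (.up ℤ)).obj (CochainComplex.mappingCone f)) := by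
  refine ⟨min (a₁ - 1) a₂, max b₁ b₂,
    CochainComplex.isStrictlyGE_mappingCone f a₁ a₂ _ (by simp) (by simp), ?_⟩
  change (CochainComplex.mappingCone f).IsStrictlyLE _
  rw [CochainComplex.isStrictlyLE_iff]
  intro i hi
  simp only [max_lt_iff] at hi
  rw [CochainComplex.mappingCone.isZero_X_iff]
  exact ⟨K.isZero_of_isStrictlyLE b₁ _ (by lia), L.isZero_of_isStrictlyLE b₂ _ (by lia)⟩

instance : (bounded 𝒜).IsTriangulatedClosed₃ where
  ext₃' T hT h₁ h₂ := by
    obtain ⟨a₁, b₁, _, _⟩ := h₁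
    obtain ⟨a₂, b₂, _, _⟩ := h₂
    obtain ⟨f, ⟨e⟩⟩ := exists_iso_mappingCone 𝒜 T hT
    exact ⟨_, bounded_mappingCone 𝒜 f a₁ a₂ b₁ b₂, ⟨e⟩⟩

instance : (bounded 𝒜).IsTriangulated where
  toIsTriangulatedClosed₂ := .of_isTriangulatedClosed₃

/-- The bounded homotopy category `K^b(𝒜)`. -/
abbrev Kb := (bounded 𝒜).FullSubcategory

/-- The functor `𝒜 ⥤ K^b(𝒜)` sending an object to the complex concentrated in degree `0`. -/
def toKb : 𝒜 ⥤ Kb 𝒜 :=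
  (bounded 𝒜).lift (HomotopyCategory.singleFunctor 𝒜 0) (fun X ↦ by
    rw [← HomotopyCategory.quotient_obj_singleFunctors_obj]
    exact ⟨0, 0,
      inferInstanceAs (((CochainComplex.singleFunctor 𝒜 0).obj X).IsStrictlyGE 0),
      inferInstanceAs (((CochainComplex.singleFunctor 𝒜 0).obj X).IsStrictlyLE 0)⟩)

instance : (toKb 𝒜).Additive := by
  dsimp [toKb]
  infer_instance

variable {𝒜}

variable (C : ObjectProperty 𝒜)

/-- The `C`-acyclic complexes, as objects of `K(𝒜)`. -/
def relAcyclic : ObjectProperty (HomotopyCategory 𝒜 (.up ℤ)) :=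
  fun X ↦ IsHomFromExact C X.as

lemma relAcyclic_iff (X : HomotopyCategory 𝒜 (.up ℤ)) :
    relAcyclic C X ↔ ∀ c : 𝒜, C c →
      (HomotopyCategory.subcategoryAcyclic AddCommGrpCat.{v}).inverseImage
        ((preadditiveCoyoneda.obj (op c)).mapHomotopyCategory (.up ℤ)) X := by
  refine forall₂_congr fun c _ ↦ ?_
  exact (HomotopyCategory.quotient_obj_mem_subcategoryAcyclic_iff_acyclic _).symm

instance : (relAcyclic C).IsClosedUnderIsomorphisms where
  of_iso e h := by
    rw [relAcyclic_iff] at h ⊢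
    exact fun c hc ↦ ObjectProperty.prop_of_iso _ e (h c hc)

instance : (relAcyclic C).IsTriangulated where
  exists_zero := ⟨0, isZero_zero _, by
    rw [relAcyclic_iff]
    exact fun c _ ↦ ObjectProperty.prop_zero _⟩
  isStableUnderShiftBy n := ⟨fun X hX ↦ by
    rw [ObjectProperty.prop_shift_iff]
    rw [relAcyclic_iff] at hX ⊢
    exact fun c hc ↦ ObjectProperty.le_shift _ n _ (hX c hc)⟩
  toIsTriangulatedClosed₂ := .mk' (fun T hT h₁ h₃ ↦ by
    rw [relAcyclic_iff] at h₁ h₃ ⊢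
    exact fun c hc ↦ ObjectProperty.ext_of_isTriangulatedClosed₂ _ T hT (h₁ c hc) (h₃ c hc))

/-- `K^b_{C-ac}(𝒜)`, as a class of objects of `K^b(𝒜)`. -/
def kbRelAcyclic : ObjectProperty (Kb 𝒜) :=
  (relAcyclic C).inverseImage (bounded 𝒜).ι

instance : (kbRelAcyclic C).IsTriangulated :=
  inferInstanceAs ((relAcyclic C).inverseImage (bounded 𝒜).ι).IsTriangulated

/-- The bounded `C`-derived category `D^b_C(𝒜) = K^b(𝒜) / K^b_{C-ac}(𝒜)`. -/
abbrev Db := (kbRelAcyclic C).trW.Localization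

/-- The quotient functor `K^b(𝒜) ⥤ D^b_C(𝒜)`. -/
abbrev Qb : Kb 𝒜 ⥤ Db C := (kbRelAcyclic C).trW.Q

/-- `K^b(C)`, as a class of objects of `K^b(𝒜)`: the bounded complexes with terms in `C`. -/
def kbOf : ObjectProperty (Kb 𝒜) :=
  fun X ↦ ∀ n : ℤ, C (X.obj.as.X n)

/-- `K^b(C)`, as a class of objects of `D^b_C(𝒜)`: the objects isomorphic in `D^b_C(𝒜)` to a
bounded complex with terms in `C`. -/
def dbOf : ObjectProperty (Db C) :=
  (kbOf C).map (Qb C)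

/-- A morphism from a bounded complex with terms in `C` to a `C`-acyclic complex is
null-homotopic. -/
lemma homotopy_zero {K L : CochainComplex 𝒜 ℤ} (a : ℤ) [K.IsStrictlyGE a]
    (hK : ∀ n : ℤ, C (K.X n)) (hL : IsHomFromExact C L) (m : ℕ) :
    ∀ f : K ⟶ L, (∀ i : ℤ, a + m ≤ i → f.f i = 0) → Nonempty (Homotopy f 0) := by
  induction m with
  | zero =>
    intro f hf
    refine ⟨Homotopy.ofEq ?_⟩
    ext i
    by_cases hi : i < a
    · exact (K.isZero_of_isStrictlyGE a i hi).eq_of_src _ _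
    · simpa using hf i (by simp; lia)
  | succ m hm =>
    intro f hf
    obtain ⟨h, hh⟩ : ∃ h : K.X (a + m) ⟶ L.X (a + m - 1),
        h ≫ L.d (a + m - 1) (a + m) = f.f (a + m) := by
      have hex := hL _ (hK (a + m)) (a + m)
      rw [HomologicalComplex.exactAt_iff' _ (a + m - 1) (a + m) (a + m + 1) (by simp) (by simp),
        ShortComplex.ab_exact_iff] at hex
      obtain ⟨h, hh⟩ := hex (f.f (a + m)) (by
        change f.f (a + m) ≫ L.d _ _ = 0
        rw [f.comm, hf _ (by push_cast; lia), comp_zero])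
      exact ⟨h, hh⟩
    let s : ∀ i j : ℤ, (ComplexShape.up ℤ).Rel j i → (K.X i ⟶ L.X j) := fun i j hij ↦
      if hi : i = a + m then
        (K.XIsoOfEq hi).hom ≫ h ≫ (L.XIsoOfEq (by simp at hij; lia)).hom else 0
    obtain ⟨g⟩ := hm (f - Homotopy.nullHomotopicMap' s) (by
      intro i hi
      have e : (Homotopy.nullHomotopicMap' s).f i = f.f i := by
        rw [Homotopy.nullHomotopicMap'_f (k₂ := i - 1) (k₁ := i) (k₀ := i + 1)
          (by simp) (by simp)]
        have h1 : s (i + 1) i (by simp) = 0 := dif_neg (by lia)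
        rw [h1, comp_zero, zero_add]
        by_cases hi' : i = a + m
        · subst hi'
          simp [s, hh]
        · have h2 : s i (i - 1) (by simp) = 0 := dif_neg hi'
          rw [h2, zero_comp, hf i (by push_cast; lia)]
      rw [HomologicalComplex.sub_f_apply, e, sub_self])
    exact ⟨(Homotopy.ofEq (by simp)).trans ((g.add (Homotopy.nullHomotopy' s)).trans
      (Homotopy.ofEq (by simp)))⟩

lemma kbOf_le_leftOrthogonal : kbOf C ≤ (kbRelAcyclic C).leftOrthogonal := by
  rintro X hX Y f hY
  obtain ⟨a, b, ha, hb⟩ := X.property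
  obtain ⟨g, hg⟩ := (HomotopyCategory.quotient 𝒜 (.up ℤ)).map_surjective
    (X := X.obj.as) (Y := Y.obj.as) f.hom
  obtain ⟨h⟩ := homotopy_zero C a hX hY (b - a + 1).toNat g (fun i hi ↦
    (CochainComplex.isZero_of_isStrictlyLE X.obj.as b i (by lia)).eq_of_src _ _)
  ext
  rw [← hg, HomotopyCategory.eq_of_homotopy _ _ h, Functor.map_zero]
  rfl

variable [C.IsClosedUnderFiniteProducts]

instance : (kbOf C).ContainsZero where
  exists_zero := by
    obtain ⟨Z, hZ, hZ'⟩ := C.exists_prop_of_containsZero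
    refine ⟨(toKb 𝒜).obj Z, (toKb 𝒜).map_isZero hZ, fun n ↦ ?_⟩
    refine C.prop_of_iso (IsZero.iso hZ ?_) hZ'
    change IsZero (((HomologicalComplex.single 𝒜 (.up ℤ) 0).obj Z).X n)
    by_cases hn : n = 0
    · subst hn
      exact hZ.of_iso (HomologicalComplex.singleObjXSelf (.up ℤ) 0 Z)
    · exact HomologicalComplex.isZero_single_obj_X _ _ _ _ hn

instance : (kbOf C).IsStableUnderShift ℤ where
  isStableUnderShiftBy n := ⟨fun X hX i ↦ by
    have e : ((shiftFunctor (Kb 𝒜) n).obj X).obj =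
        (HomotopyCategory.quotient 𝒜 (.up ℤ)).obj
          ((shiftFunctor (CochainComplex 𝒜 ℤ) n).obj X.obj.as) :=
      Eq.trans (by with_unfolding_all rfl)
        (HomotopyCategory.shift_quotient_obj X.obj.as n)
    rw [e]
    exact hX (i + n)⟩

instance : (kbOf C).IsTriangulatedClosed₃ where
  ext₃' T hT h₁ h₂ := by
    obtain ⟨a₁, b₁, _, _⟩ := T.obj₁.property
    obtain ⟨a₂, b₂, _, _⟩ := T.obj₂.property
    obtain ⟨f, ⟨e⟩⟩ := exists_iso_mappingCone 𝒜 _ ((bounded 𝒜).ι.map_distinguished T hT)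
    exact ⟨⟨_, bounded_mappingCone 𝒜 (K := T.obj₁.obj.as) (L := T.obj₂.obj.as) f a₁ a₂ b₁ b₂⟩, fun n ↦ C.prop_of_iso
      (HomologicalComplex.homotopyCofiber.XIsoBiprod f n (n + 1) rfl).symm
        (prop_biprod C (h₁ (n + 1)) (h₂ n)), ⟨(bounded 𝒜).fullyFaithfulι.preimageIso e⟩⟩

instance : (kbOf C).IsTriangulated where
  toIsTriangulatedClosed₂ := .of_isTriangulatedClosed₃

instance : ((kbOf C).ι ⋙ Qb C).Full where
  map_surjective {X Y} f := by
    obtain ⟨g, hg⟩ := ((kbOf_le_leftOrthogonal C _ X.property).map_bijective_of_isTriangulated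
      (Qb C) Y.obj).2 f
    exact ⟨(kbOf C).homMk g, hg⟩

instance : (dbOf C).IsTriangulated := by
  unfold dbOf
  rw [← Functor.essImage_ι_comp]
  infer_instance

/-- The `C`-singularity category `D_{C-sg}(𝒜) = D^b_C(𝒜) / K^b(C)`. -/
abbrev Dsg := (dbOf C).trW.Localization

/-- The quotient functor `D^b_C(𝒜) ⥤ D_{C-sg}(𝒜)`. -/
abbrev Qsg : Db C ⥤ Dsg C := (dbOf C).trW.Q

/-- The canonical functor `𝒜 ⥤ K^b(𝒜) ⥤ D^b_C(𝒜) ⥤ D_{C-sg}(𝒜)`. -/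
abbrev toDsg : 𝒜 ⥤ Dsg C := toKb 𝒜 ⋙ Qb C ⋙ Qsg C

/-- The functor `θ : 𝒢(C) ⥤ D_{C-sg}(𝒜)`. -/
abbrev theta : (gorenstein C).FullSubcategory ⥤ Dsg C := (gorenstein C).ι ⋙ toDsg C

end HomotopyCategories

end RelSing

end

/-!
A morphism `M ⟶ N` in `D^b_C(𝒜)` is a right fraction whose source can be truncated to degrees `≤ 0`,
so `𝒜 ⥤ D^b_C(𝒜)` is fully faithful: admissibility makes the objects of `C` generators, hence
`C`-acyclic complexes acyclic. Sequences that are `Hom_𝒜(C, -)`-short exact become distinguished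
triangles, and for `M` in `^{⊥_C} C` or in `𝒢(C)` dimension shifting along the kernels of a
resolution by objects of `C` gives `Hom(M, c[n]) = 0` in `D^b_C(𝒜)` for `c` in `C` and `n > 0`. By
brutal truncation, every morphism from `M` to a complex in `K^b(C)` then factors through one in
degrees `≥ 0`. Such a complex `P` satisfies `Hom(P, N[1]) = 0`, so that morphisms `M ⟶ N` in the
`C`-singularity category lift to `𝒜`, and a morphism `P ⟶ N` factors through `P ^ 0`, so that the
morphisms of `𝒜` which become zero are those factoring through `C`.
-/

noncomputable section

namespace RelSing

section SeparatingClasses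

variable {𝒜 : Type u} [Category.{v} 𝒜] {C : ObjectProperty 𝒜}

lemma epi_of_forall_exists_comp_eq (hC : C.IsSeparating) {X Y : 𝒜} (f : X ⟶ Y)
    (hf : ∀ c : 𝒜, C c → ∀ y : c ⟶ Y, ∃ x : c ⟶ X, x ≫ f = y) : Epi f where
  left_cancellation a b hab := hC a b fun c hc y ↦ by
    obtain ⟨x, rfl⟩ := hf c hc y
    rw [Category.assoc, Category.assoc, hab]

lemma exact_of_forall_exists_lift [Abelian 𝒜] (hC : C.IsSeparating) (S : ShortComplex 𝒜)
    (hS : ∀ c : 𝒜, C c → ∀ x : c ⟶ S.X₂, x ≫ S.g = 0 → ∃ y : c ⟶ S.X₁, y ≫ S.f = x) :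
    S.Exact := by
  rw [ShortComplex.exact_iff_epi_kernel_lift]
  refine epi_of_forall_exists_comp_eq hC _ fun c hc y ↦ ?_
  obtain ⟨x, hx⟩ := hS c hc (y ≫ kernel.ι S.g) (by rw [Category.assoc, kernel.condition, comp_zero])
  exact ⟨x, by rw [← cancel_mono (kernel.ι S.g), Category.assoc, kernel.lift_ι, hx]⟩

lemma IsAdmissible.isSeparating [Abelian 𝒜] (hC : IsAdmissible C) : C.IsSeparating := by
  intro D Y a b h
  obtain ⟨X, f, hf⟩ := hC.contravariantlyFinite D
  have := hC.epi_of_isRightApproximation f hf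
  exact (cancel_epi f).1 (h X hf.1 f)

end SeparatingClasses

section HomExactness

variable {𝒜 : Type u} [Category.{v} 𝒜] [Abelian 𝒜] {C : ObjectProperty 𝒜}

lemma exactAt_homFrom_iff (c : 𝒜) (K : CochainComplex 𝒜 ℤ) {i j k : ℤ} (hij : i + 1 = j)
    (hjk : j + 1 = k) :
    (homFrom c K).ExactAt j ↔
      ∀ x : c ⟶ K.X j, x ≫ K.d j k = 0 → ∃ y : c ⟶ K.X i, y ≫ K.d i j = x := by
  rw [HomologicalComplex.exactAt_iff' _ i j k (ComplexShape.prev_eq' _ hij)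
    (ComplexShape.next_eq' _ hjk)]
  exact ShortComplex.ab_exact_iff _

lemma exactAt_homTo_iff (K : CochainComplex 𝒜 ℤ) (c : 𝒜) {i j k : ℤ} (hij : i + 1 = j)
    (hjk : j + 1 = k) :
    (homTo K c).ExactAt j ↔
      ∀ x : K.X j ⟶ c, K.d i j ≫ x = 0 → ∃ y : K.X k ⟶ c, K.d j k ≫ y = x := by
  rw [HomologicalComplex.exactAt_iff' _ k j i (ComplexShape.prev_eq' _ hjk)
    (ComplexShape.next_eq' _ hij)]
  exact ShortComplex.ab_exact_iff _

lemma IsHomFromExact.acyclic (hC : C.IsSeparating) {K : CochainComplex 𝒜 ℤ}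
    (hK : IsHomFromExact C K) : K.Acyclic := by
  intro j
  rw [HomologicalComplex.exactAt_iff' _ (j - 1) j (j + 1) (by simp) (by simp)]
  exact exact_of_forall_exists_lift hC _ fun c hc ↦
    (exactAt_homFrom_iff c K (sub_add_cancel j 1) rfl).1 (hK c hc j)

lemma isHomToExact_of_homotopy {K : CochainComplex 𝒜 ℤ} (h : Homotopy (𝟙 K) 0) :
    IsHomToExact C K := fun c _ j ↦ by
  refine (exactAt_homTo_iff K c (sub_add_cancel j 1) rfl).2 fun x hx ↦ ⟨h.hom (j + 1) j ≫ x, ?_⟩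
  have hj : 𝟙 (K.X j) = K.d j (j + 1) ≫ h.hom (j + 1) j + h.hom j (j - 1) ≫ K.d (j - 1) j := by
    simpa [dNext_eq h.hom (show (ComplexShape.up ℤ).Rel j (j + 1) from rfl),
      prevD_eq h.hom (show (ComplexShape.up ℤ).Rel (j - 1) j from sub_add_cancel j 1)]
      using h.comm j
  calc K.d j (j + 1) ≫ h.hom (j + 1) j ≫ x
    _ = (K.d j (j + 1) ≫ h.hom (j + 1) j + h.hom j (j - 1) ≫ K.d (j - 1) j) ≫ x := by simp [hx]
    _ = x := by rw [← hj, Category.id_comp]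

/-- A sequence in `𝒜` is `Hom_𝒜(C, -)`-short exact if it becomes short exact after applying
`Hom_𝒜(c, -)` for all `c` in `C`. For sequences with terms in `𝒢(C)` these are the conflations. -/
def IsRelShortExact (C : ObjectProperty 𝒜) (S : ShortComplex 𝒜) : Prop :=
  ∀ c : 𝒜, C c → (S.map (preadditiveCoyoneda.obj (op c))).ShortExact

lemma IsRelShortExact.of_mono {S : ShortComplex 𝒜} [Mono S.f]
    (exact : ∀ c : 𝒜, C c → ∀ x : c ⟶ S.X₂, x ≫ S.g = 0 → ∃ y : c ⟶ S.X₁, y ≫ S.f = x)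
    (surjective : ∀ c : 𝒜, C c → ∀ x : c ⟶ S.X₃, ∃ y : c ⟶ S.X₂, y ≫ S.g = x) :
    IsRelShortExact C S := fun c hc ↦
  { exact := (ShortComplex.ab_exact_iff _).2 (exact c hc)
    mono_f := (AddCommGrpCat.mono_iff_injective _).2 fun _ _ h ↦ (cancel_mono S.f).1 h
    epi_g := (AddCommGrpCat.epi_iff_surjective _).2 (surjective c hc) }

lemma IsRelShortExact.exists_comp_eq {S : ShortComplex 𝒜} (hS : IsRelShortExact C S) {c : 𝒜}
    (hc : C c) (x : c ⟶ S.X₃) : ∃ y : c ⟶ S.X₂, y ≫ S.g = x :=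
  (AddCommGrpCat.epi_iff_surjective _).1 (hS c hc).epi_g x

lemma IsRelShortExact.map_single_eval {S : ShortComplex 𝒜} (hS : IsRelShortExact C S) (n : ℤ) :
    IsRelShortExact C ((S.map (CochainComplex.singleFunctor 𝒜 0)).map
      (HomologicalComplex.eval 𝒜 (.up ℤ) n)) := by
  by_cases hn : n = 0
  · subst hn
    let e := S.mapNatIso (HomologicalComplex.singleCompEvalIsoSelf 𝒜 (.up ℤ) 0).symm
    exact fun c hc ↦ ShortComplex.shortExact_of_iso
      ((preadditiveCoyoneda.obj (op c)).mapShortComplex.mapIso e) (hS c hc)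
  · have hX (X : 𝒜) := HomologicalComplex.isZero_single_obj_X (.up ℤ) 0 X n hn
    have : Mono ((S.map (CochainComplex.singleFunctor 𝒜 0)).map
      (HomologicalComplex.eval 𝒜 (.up ℤ) n)).f := ⟨fun _ _ _ ↦ (hX _).eq_of_tgt _ _⟩
    exact .of_mono (fun _ _ _ _ ↦ ⟨0, (hX _).eq_of_tgt _ _⟩)
      (fun _ _ _ ↦ ⟨0, (hX _).eq_of_tgt _ _⟩)

end HomExactness

section RelativeQuasiIsomorphisms

open CochainComplex

variable {𝒜 : Type u} [Category.{v} 𝒜] [Abelian 𝒜] {C : ObjectProperty 𝒜}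
  {K L : CochainComplex 𝒜 ℤ}

lemma acyclic_mappingCone_iff_quasiIso {ℬ : Type*} [Category* ℬ] [Abelian ℬ]
    {K L : CochainComplex ℬ ℤ} (f : K ⟶ L) : (mappingCone f).Acyclic ↔ QuasiIso f := by
  rw [← HomologicalComplex.mem_quasiIso_iff, ← HomotopyCategory.quotient_map_mem_quasiIso_iff,
    HomotopyCategory.quasiIso_eq_trW_subcategoryAcyclic,
    ← HomotopyCategory.quotient_obj_mem_subcategoryAcyclic_iff_acyclic]
  exact ((HomotopyCategory.subcategoryAcyclic ℬ).trW_iff_of_distinguished _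
    (HomotopyCategory.mappingCone_triangleh_distinguished f)).symm

lemma isHomFromExact_mappingCone_iff_isRelQuasiIso (f : K ⟶ L) :
    IsHomFromExact C (mappingCone f) ↔ IsRelQuasiIso C f := by
  refine forall₂_congr fun c _ ↦ ?_
  rw [← acyclic_mappingCone_iff_quasiIso]
  let e := mappingCone.mapHomologicalComplexIso f (preadditiveCoyoneda.obj (op c))
  exact forall_congr' fun n ↦ ⟨fun h ↦ h.of_iso e, fun h ↦ h.of_iso e.symm⟩

lemma isRelQuasiIso_iff (f : K ⟶ L) :
    IsRelQuasiIso C f ↔ ∀ c : 𝒜, C c → ∀ i j k : ℤ, i + 1 = j → j + 1 = k →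
      ∀ (x : c ⟶ K.X k) (y : c ⟶ L.X j), x ≫ K.d k (k + 1) = 0 →
        x ≫ f.f k + y ≫ L.d j k = 0 →
        ∃ (z : c ⟶ K.X j) (w : c ⟶ L.X i), z ≫ K.d j k = -x ∧ z ≫ f.f j + w ≫ L.d i j = y := by
  rw [← isHomFromExact_mappingCone_iff_isRelQuasiIso]
  refine forall₂_congr fun c _ ↦ ⟨fun h i j k hij hjk x y hx hxy ↦ ?_, fun h j ↦ ?_⟩
  · obtain ⟨z, hz⟩ := (exactAt_homFrom_iff c _ hij hjk).1 (h j)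
      (x ≫ (mappingCone.inl f).v k j (by lia) + y ≫ (mappingCone.inr f).f j) (by
        rw [mappingCone.ext_to_iff f k (k + 1) rfl]
        constructor
        · simp [mappingCone.d_fst_v f j k (k + 1) hjk rfl, hx]
        · simpa [mappingCone.d_snd_v f j k hjk] using hxy)
    refine ⟨z ≫ (mappingCone.fst f).1.v i j hij, z ≫ (mappingCone.snd f).v i i (add_zero i),
      ?_, ?_⟩
    · simpa [mappingCone.d_fst_v f i j k hij hjk, neg_eq_iff_eq_neg]
        using congr($hz ≫ (mappingCone.fst f).1.v j k hjk)
    · simpa [mappingCone.d_snd_v f i j hij]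
        using congr($hz ≫ (mappingCone.snd f).v j j (add_zero j))
  · refine (exactAt_homFrom_iff c _ (sub_add_cancel j 1) rfl).2 fun x hx ↦ ?_
    have hfst : (x ≫ (mappingCone.fst f).1.v j (j + 1) rfl) ≫ K.d (j + 1) (j + 1 + 1) = 0 := by
      simpa [mappingCone.d_fst_v f j (j + 1) _ rfl rfl]
        using congr($hx ≫ (mappingCone.fst f).1.v (j + 1) (j + 1 + 1) rfl)
    have hsnd : (x ≫ (mappingCone.fst f).1.v j (j + 1) rfl) ≫ f.f (j + 1) +
        (x ≫ (mappingCone.snd f).v j j (add_zero j)) ≫ L.d j (j + 1) = 0 := by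
      simpa [mappingCone.d_snd_v f j (j + 1) rfl]
        using congr($hx ≫ (mappingCone.snd f).v (j + 1) (j + 1) (add_zero _))
    obtain ⟨z, w, hz, hw⟩ := h (j - 1) j (j + 1) (sub_add_cancel j 1) rfl _ _ hfst hsnd
    refine ⟨z ≫ (mappingCone.inl f).v j (j - 1) (by lia) + w ≫ (mappingCone.inr f).f (j - 1), ?_⟩
    rw [mappingCone.ext_to_iff f j (j + 1) rfl]
    constructor
    · simp [mappingCone.d_fst_v f (j - 1) j (j + 1) (sub_add_cancel j 1) rfl, hz]
    · simpa [mappingCone.d_snd_v f (j - 1) j (sub_add_cancel j 1)] using hw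

lemma quasiIso_map_descShortComplex {ℬ : Type*} [Category* ℬ] [Abelian ℬ] (F : 𝒜 ⥤ ℬ) [F.Additive]
    {S : ShortComplex (CochainComplex 𝒜 ℤ)} (hS : (S.map (F.mapHomologicalComplex _)).ShortExact) :
    QuasiIso ((F.mapHomologicalComplex _).map (mappingCone.descShortComplex S)) := by
  rw [← mappingCone.mapHomologicalComplexIso_hom_descShortComplex]
  exact (HomologicalComplex.quasiIso ℬ _).comp_mem _ _
    (inferInstance : QuasiIso (mappingCone.mapHomologicalComplexIso S.f F).hom)
    (mappingCone.quasiIso_descShortComplex hS)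

lemma isRelQuasiIso_descShortComplex {S : ShortComplex (CochainComplex 𝒜 ℤ)}
    (hS : ∀ n, IsRelShortExact C (S.map (HomologicalComplex.eval 𝒜 (.up ℤ) n))) :
    IsRelQuasiIso C (mappingCone.descShortComplex S) := fun c hc ↦
  quasiIso_map_descShortComplex _
    (HomologicalComplex.shortExact_of_degreewise_shortExact _ fun n ↦ hS n c hc)

end RelativeQuasiIsomorphisms

section Triangulated

variable {𝒯 : Type*} [Category* 𝒯] [HasZeroObject 𝒯] [HasShift 𝒯 ℤ] [Preadditive 𝒯]
  [∀ n : ℤ, (shiftFunctor 𝒯 n).Additive] [Pretriangulated 𝒯] {X Y Z W : 𝒯}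
  {f : X ⟶ Y} {g : Y ⟶ Z} {h : Z ⟶ X⟦(1 : ℤ)⟧}

lemma distinguished_of_iso₃ (hT : Triangle.mk f g h ∈ distTriang 𝒯) (e : Z ≅ W) :
    Triangle.mk f (g ≫ e.hom) (e.inv ≫ h) ∈ distTriang 𝒯 :=
  isomorphic_distinguished _ hT _
    (Triangle.isoMk _ _ (Iso.refl X) (Iso.refl Y) e.symm
      (show f ≫ 𝟙 Y = 𝟙 X ≫ f by simp)
      (show (g ≫ e.hom) ≫ e.inv = 𝟙 Y ≫ g by simp)
      (show (e.inv ≫ h) ≫ (𝟙 X)⟦1⟧' = e.inv ≫ h by simp))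

lemma exists_extension_of_distinguished (hT : Triangle.mk f g h ∈ distTriang 𝒯) (u : X ⟶ W)
    (hu : h ≫ u⟦(1 : ℤ)⟧' = 0) : ∃ v : Y ⟶ W, f ≫ v = u := by
  obtain ⟨v : Y⟦(1 : ℤ)⟧ ⟶ W⟦(1 : ℤ)⟧, hv : u⟦(1 : ℤ)⟧' = (-f⟦1⟧') ≫ v⟩ :=
    Triangle.yoneda_exact₃ _ (rot_of_distTriang _ hT) (u⟦(1 : ℤ)⟧') hu
  obtain ⟨v, rfl⟩ := (shiftFunctor 𝒯 (1 : ℤ)).map_surjective v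
  exact ⟨-v, (shiftFunctor 𝒯 (1 : ℤ)).map_injective (by simp [hv])⟩

lemma hom_eq_zero_of_distinguished (hT : Triangle.mk f g h ∈ distTriang 𝒯) {W' : 𝒯}
    (e : W ≅ W'⟦(1 : ℤ)⟧) (hY : ∀ u : Y ⟶ W, u = 0)
    (hX : ∀ u : X ⟶ W', ∃ v : Y ⟶ W', f ≫ v = u) (u : Z ⟶ W) : u = 0 := by
  obtain ⟨a : X⟦(1 : ℤ)⟧ ⟶ W, rfl : u = h ≫ a⟩ := Triangle.yoneda_exact₃ _ hT u (hY _)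
  obtain ⟨b, hb⟩ := (shiftFunctor 𝒯 (1 : ℤ)).map_surjective (a ≫ e.hom)
  obtain ⟨v, rfl⟩ := hX b
  have hf : h ≫ f⟦(1 : ℤ)⟧' = 0 := comp_distTriang_mor_zero₃₁ _ hT
  rw [← cancel_mono e.hom, Category.assoc, ← hb, Functor.map_comp, reassoc_of% hf, zero_comp,
    zero_comp]

end Triangulated

section VerdierQuotients

variable {𝒯 𝒟 : Type*} [Category* 𝒯] [HasZeroObject 𝒯] [HasShift 𝒯 ℤ] [Preadditive 𝒯]
  [∀ n : ℤ, (shiftFunctor 𝒯 n).Additive] [Pretriangulated 𝒯] [IsTriangulated 𝒯] [Category* 𝒟]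
  {U V : ObjectProperty 𝒯} [U.IsTriangulated] {M : 𝒯}

lemma exists_factorization_of_map_eq_map_zero (L : 𝒯 ⥤ 𝒟) [L.IsLocalization U.trW]
    (hM : ∀ A, U A → ∀ p : M ⟶ A, ∃ (B : 𝒯) (g : M ⟶ B) (i : B ⟶ A), V B ∧ g ≫ i = p)
    {N : 𝒯} (f : M ⟶ N) (hf : L.map f = L.map 0) :
    ∃ (B : 𝒯) (g : M ⟶ B) (a : B ⟶ N), V B ∧ g ≫ a = f := by
  obtain ⟨X, s, ⟨A, p, δ, hT, hA⟩, hs⟩ := (MorphismProperty.map_eq_iff_precomp L U.trW _ _).1 hf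
  obtain ⟨a : A ⟶ N, rfl : f = p ≫ a⟩ := Triangle.yoneda_exact₂ _ hT f (hs.trans comp_zero)
  obtain ⟨B, g, i, hB, rfl⟩ := hM A hA p
  exact ⟨B, g, i ≫ a, hB, (Category.assoc _ _ _).symm⟩

lemma localization_map_surjective (L : 𝒯 ⥤ 𝒟) [L.IsLocalization U.trW] (hVU : V ≤ U)
    (hM : ∀ A, U A → ∀ p : M ⟶ A, ∃ (B : 𝒯) (g : M ⟶ B) (i : B ⟶ A), V B ∧ g ≫ i = p)
    {N : 𝒯} (hN : ∀ B, V B → ∀ u : B ⟶ N⟦(1 : ℤ)⟧, u = 0) :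
    Function.Surjective (L.map : (M ⟶ N) → _) := by
  intro f
  obtain ⟨φ, rfl⟩ := Localization.exists_rightFraction L U.trW f
  obtain ⟨A, p, δ, hT, hA⟩ := φ.hs
  obtain ⟨B, g, i, hB, rfl⟩ := hM A hA p
  obtain ⟨X, t, δ', hT'⟩ := distinguished_cocone_triangle₁ g
  have ht : t ≫ g = 0 := comp_distTriang_mor_zero₁₂ _ hT'
  obtain ⟨a : X ⟶ φ.X', rfl : t = a ≫ φ.s⟩ :=
    Triangle.coyoneda_exact₂ _ hT t (show t ≫ g ≫ i = 0 by rw [reassoc_of% ht, zero_comp])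
  obtain ⟨l, hl⟩ := exists_extension_of_distinguished hT' (a ≫ φ.f) (hN B hB _)
  have : IsIso (L.map (a ≫ φ.s)) :=
    Localization.inverts L U.trW _ (ObjectProperty.trW.mk U hT' (hVU B hB))
  refine ⟨l, (cancel_epi (L.map (a ≫ φ.s))).1 ?_⟩
  rw [← L.map_comp, hl, L.map_comp, L.map_comp, Category.assoc,
    MorphismProperty.RightFraction.map_s_comp_map]

end VerdierQuotients

section BoundedHomotopyCategory

open CochainComplex

variable {𝒜 : Type u} [Category.{v} 𝒜] [Abelian 𝒜] {C : ObjectProperty 𝒜}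

/-- The morphism `X ⟶ Y` of `K^b(𝒜)` given by a morphism of complexes. -/
def kbHom (X Y : Kb 𝒜) (f : X.obj.as ⟶ Y.obj.as) : X ⟶ Y :=
  (bounded 𝒜).homMk ((HomotopyCategory.quotient 𝒜 (.up ℤ)).map f)

/-- The bounded complex `K` as an object of `K^b(𝒜)`. -/
def kbMk (K : CochainComplex 𝒜 ℤ) (a b : ℤ) (ha : K.IsStrictlyGE a) (hb : K.IsStrictlyLE b) :
    Kb 𝒜 := ⟨(HomotopyCategory.quotient 𝒜 (.up ℤ)).obj K, a, b, ha, hb⟩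

/-- The mapping cone of a morphism of bounded complexes, as an object of `K^b(𝒜)`. -/
def kbCone (X Y : Kb 𝒜) (f : X.obj.as ⟶ Y.obj.as) : Kb 𝒜 :=
  ⟨(HomotopyCategory.quotient 𝒜 (.up ℤ)).obj (mappingCone f), by
    obtain ⟨a₁, b₁, _, _⟩ := X.property
    obtain ⟨a₂, b₂, _, _⟩ := Y.property
    exact bounded_mappingCone 𝒜 (K := X.obj.as) (L := Y.obj.as) f a₁ a₂ b₁ b₂⟩

lemma kbHom_surjective (X Y : Kb 𝒜) : Function.Surjective (kbHom X Y) := fun g ↦ by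
  obtain ⟨f, hf⟩ := (HomotopyCategory.quotient 𝒜 (.up ℤ)).map_surjective
    (X := X.obj.as) (Y := Y.obj.as) g.hom
  exact ⟨f, by ext; exact hf⟩

lemma kbHom_comp {X Y Z : Kb 𝒜} (f : X.obj.as ⟶ Y.obj.as) (g : Y.obj.as ⟶ Z.obj.as) :
    kbHom X Z (f ≫ g) = kbHom X Y f ≫ kbHom Y Z g := by
  ext
  exact (HomotopyCategory.quotient 𝒜 (.up ℤ)).map_comp _ _

lemma kbHom_zero (X Y : Kb 𝒜) : kbHom X Y 0 = 0 := by
  ext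
  exact (HomotopyCategory.quotient 𝒜 (.up ℤ)).map_zero _ _

lemma homotopy_of_kbHom_eq {X Y : Kb 𝒜} {f g : X.obj.as ⟶ Y.obj.as}
    (h : kbHom X Y f = kbHom X Y g) : Nonempty (Homotopy f g) :=
  ⟨HomotopyCategory.homotopyOfEq _ _ congr(($h).hom)⟩

lemma kb_hom_eq_zero {X Y : Kb 𝒜}
    (h : ∀ i, IsZero (X.obj.as.X i) ∨ IsZero (Y.obj.as.X i)) (f : X ⟶ Y) : f = 0 := by
  obtain ⟨f, rfl⟩ := kbHom_surjective X Y f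
  obtain rfl : f = 0 := by
    ext i
    obtain hi | hi := h i
    exacts [hi.eq_of_src _ _, hi.eq_of_tgt _ _]
  exact kbHom_zero X Y

lemma exists_iso_of_distinguished {X Y Z : Kb 𝒜} {f : X ⟶ Y} {g : Y ⟶ Z} {h : Z ⟶ X⟦(1 : ℤ)⟧}
    (hT : Triangle.mk f g h ∈ distTriang (Kb 𝒜)) {Z' : HomotopyCategory 𝒜 (.up ℤ)}
    {g' : Y.obj ⟶ Z'} {h' : Z' ⟶ X.obj⟦(1 : ℤ)⟧} (hT' : Triangle.mk f.hom g' h' ∈ distTriang _) :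
    ∃ e : Z.obj ≅ Z', g.hom ≫ e.hom = g' := by
  let e := isoTriangleOfIso₁₂ _ _ ((bounded 𝒜).ι.map_distinguished _ hT) hT'
    (Iso.refl _) (Iso.refl _) ((Category.comp_id _).trans (Category.id_comp _).symm)
  exact ⟨Triangle.π₃.mapIso e, e.hom.comm₂.trans (Category.id_comp _)⟩

lemma exists_kbCone_distinguished (X Y : Kb 𝒜) (f : X.obj.as ⟶ Y.obj.as) :
    ∃ h : kbCone X Y f ⟶ X⟦(1 : ℤ)⟧,
      Triangle.mk (kbHom X Y f) (kbHom Y (kbCone X Y f) (mappingCone.inr f)) h ∈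
        distTriang (Kb 𝒜) := by
  obtain ⟨Z, g, h, hT⟩ := distinguished_cocone_triangle (kbHom X Y f)
  obtain ⟨e, he⟩ := exists_iso_of_distinguished hT
    (HomotopyCategory.mappingCone_triangleh_distinguished f)
  let e' : Z ≅ kbCone X Y f := (bounded 𝒜).fullyFaithfulι.preimageIso e
  have he' : g ≫ e'.hom = kbHom Y (kbCone X Y f) (mappingCone.inr f) := by
    ext
    exact he
  exact ⟨e'.inv ≫ h, he' ▸ distinguished_of_iso₃ hT e'⟩

lemma trW_kbHom_iff {X Y : Kb 𝒜} (f : X.obj.as ⟶ Y.obj.as) :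
    (kbRelAcyclic C).trW (kbHom X Y f) ↔ IsRelQuasiIso C f := by
  have : (kbRelAcyclic C).IsClosedUnderIsomorphisms :=
    inferInstanceAs ((relAcyclic C).inverseImage (bounded 𝒜).ι).IsClosedUnderIsomorphisms
  obtain ⟨h, hT⟩ := exists_kbCone_distinguished X Y f
  exact ((kbRelAcyclic C).trW_iff_of_distinguished _ hT).trans
    (isHomFromExact_mappingCone_iff_isRelQuasiIso f)

lemma IsRelShortExact.exists_distinguished {S : ShortComplex 𝒜} (hS : IsRelShortExact C S) :
    ∃ δ : (Qb C).obj ((toKb 𝒜).obj S.X₃) ⟶ ((Qb C).obj ((toKb 𝒜).obj S.X₁))⟦(1 : ℤ)⟧,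
      Triangle.mk ((Qb C).map ((toKb 𝒜).map S.f)) ((Qb C).map ((toKb 𝒜).map S.g)) δ ∈
        distTriang (Db C) := by
  let S' := S.map (singleFunctor 𝒜 0)
  let X (M : 𝒜) := (toKb 𝒜).obj M
  obtain ⟨h, hT⟩ := exists_kbCone_distinguished (X S.X₁) (X S.X₂) S'.f
  let t := kbHom (kbCone (X S.X₁) (X S.X₂) S'.f) (X S.X₃) (mappingCone.descShortComplex S')
  have ht : (kbRelAcyclic C).trW t :=
    (trW_kbHom_iff _).2 (isRelQuasiIso_descShortComplex hS.map_single_eval)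
  let e := Localization.isoOfHom (Qb C) _ t ht
  have hg : (Qb C).map (kbHom (X S.X₂) (kbCone (X S.X₁) (X S.X₂) S'.f) (mappingCone.inr S'.f)) ≫
      e.hom = (Qb C).map ((toKb 𝒜).map S.g) := by
    refine ((Qb C).map_comp _ _).symm.trans (congrArg _ ?_)
    exact (kbHom_comp (Y := kbCone (X S.X₁) (X S.X₂) S'.f) (Z := X S.X₃) _ _).symm.trans
      (congrArg _ (mappingCone.inr_descShortComplex S'))
  exact ⟨_, hg ▸ distinguished_of_iso₃ ((Qb C).map_distinguished _ hT) e⟩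

end BoundedHomotopyCategory

section Truncation

open CochainComplex

variable {𝒜 : Type u} [Category.{v} 𝒜] [Abelian 𝒜] {C : ObjectProperty 𝒜}

lemma isIso_ιTruncLE_f (K : CochainComplex 𝒜 ℤ) {n i : ℤ} (hi : i < n) :
    IsIso ((K.ιTruncLE n).f i) := by
  obtain ⟨m, rfl⟩ : ∃ m : ℕ, n - m = i := ⟨(n - i).toNat, by lia⟩
  have hm : ¬ (ComplexShape.embeddingUpIntLE n).BoundaryLE m := by
    rw [ComplexShape.boundaryLE_embeddingUpIntLE_iff]
    lia
  have : IsIso ((HomologicalComplex.πTruncGE K.op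
      (ComplexShape.embeddingUpIntLE n).op).f (n - m)) :=
    (ComplexShape.Embedding.isIso_liftExtend_f_iff _ _ _ (i := m) rfl).2
      (HomologicalComplex.isIso_restrictionToTruncGE' _ _ _ (by simpa using hm))
  exact inferInstanceAs (IsIso ((HomologicalComplex.πTruncGE K.op
    (ComplexShape.embeddingUpIntLE n).op).f (n - m)).unop)

lemma exists_comp_ιTruncLE_f (K : CochainComplex 𝒜 ℤ) (n : ℤ) {c : 𝒜} (x : c ⟶ K.X n)
    (hx : x ≫ K.d n (n + 1) = 0) : ∃ y : c ⟶ (K.truncLE n).X n, y ≫ (K.ιTruncLE n).f n = x := by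
  let D : CochainComplex 𝒜 ℤ := (HomologicalComplex.single 𝒜 (.up ℤ) n).obj c
  let φ : D ⟶ K := HomologicalComplex.mkHomFromSingle x (by rintro _ rfl; exact hx)
  refine ⟨(HomologicalComplex.singleObjXSelf (.up ℤ) n c).inv ≫
    (inv (D.ιTruncLE n) ≫ truncLEMap φ n).f n, ?_⟩
  rw [Category.assoc, ← HomologicalComplex.comp_f, Category.assoc, ιTruncLE_naturality φ n,
    IsIso.inv_hom_id_assoc]
  exact (Iso.inv_comp_eq _).2 (HomologicalComplex.mkHomFromSingle_f x _)

lemma isRelQuasiIso_ιTruncLE (K : CochainComplex 𝒜 ℤ) (n : ℤ)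
    (hK : ∀ c : 𝒜, C c → ∀ j : ℤ, n < j → (homFrom c K).ExactAt j) :
    IsRelQuasiIso C (K.ιTruncLE n) := by
  refine (isRelQuasiIso_iff _).2 fun c hc i j k hij hjk x y hx hxy ↦ ?_
  by_cases hj : n < j
  · obtain rfl : x = 0 := ((K.truncLE n).isZero_of_isStrictlyLE n k (by lia)).eq_of_tgt _ _
    obtain ⟨w, hw⟩ := (exactAt_homFrom_iff c K hij hjk).1 (hK c hc j hj) y (by simpa using hxy)
    exact ⟨0, w, by simp, by simp [hw]⟩
  · obtain ⟨z, rfl⟩ : ∃ z : c ⟶ (K.truncLE n).X j, z ≫ (K.ιTruncLE n).f j = y := by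
      obtain hj | rfl := (not_lt.1 hj).lt_or_eq
      · have := isIso_ιTruncLE_f K hj
        exact ⟨y ≫ inv ((K.ιTruncLE n).f j), by simp⟩
      · obtain rfl : x = 0 := ((K.truncLE j).isZero_of_isStrictlyLE j k (by lia)).eq_of_tgt _ _
        subst hjk
        exact exists_comp_ιTruncLE_f K j y (by simpa using hxy)
    have : Mono ((K.ιTruncLE n).f k) :=
      inferInstanceAs (Mono ((HomologicalComplex.ιTruncLE K _).f k))
    refine ⟨z, 0, ?_, by simp⟩
    rw [← cancel_mono ((K.ιTruncLE n).f k), Preadditive.neg_comp]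
    exact (neg_eq_of_add_eq_zero_right (by simpa using hxy)).symm

lemma IsRelQuasiIso.exactAt_homFrom {K L : CochainComplex 𝒜 ℤ} {s : K ⟶ L}
    (hs : IsRelQuasiIso C s) {c : 𝒜} (hc : C c) {j : ℤ} (hj : IsZero (L.X j)) :
    (homFrom c K).ExactAt j := by
  have := hs c hc
  refine (quasiIsoAt_iff_exactAt' _ j ?_).1 (this.quasiIsoAt j)
  exact ShortComplex.exact_of_isZero_X₂ _ ((preadditiveCoyoneda.obj (op c)).map_isZero hj)

lemma exists_trW_isStrictlyLE {X Y : Kb 𝒜} {n : ℤ} (hY : IsStrictlyLE Y.obj.as n) (s : X ⟶ Y)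
    (hs : (kbRelAcyclic C).trW s) :
    ∃ (X' : Kb 𝒜) (t : X' ⟶ X), IsStrictlyLE X'.obj.as n ∧ (kbRelAcyclic C).trW t := by
  obtain ⟨s, rfl⟩ := kbHom_surjective X Y s
  obtain ⟨a, -, ha, -⟩ := X.property
  let K : CochainComplex 𝒜 ℤ := X.obj.as
  have hK : (K.truncLE n).IsStrictlyLE n := inferInstance
  let X' := kbMk (K.truncLE n) a n
    (inferInstanceAs (HomologicalComplex.IsStrictlySupported _ _)) hK
  have hs' : IsRelQuasiIso C s := (trW_kbHom_iff s).1 hs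
  exact ⟨X', kbHom X' X (K.ιTruncLE n), hK, (trW_kbHom_iff (X := X') (Y := X) _).2
    (isRelQuasiIso_ιTruncLE K n fun c hc j hj ↦
      hs'.exactAt_homFrom hc (isZero_of_isStrictlyLE Y.obj.as n j hj))⟩

end Truncation

section FullyFaithful

open CochainComplex

variable {𝒜 : Type u} [Category.{v} 𝒜] [Abelian 𝒜] {C : ObjectProperty 𝒜}

lemma exists_rightFraction_isStrictlyLE {X Y : Kb 𝒜} {n : ℤ} (hX : IsStrictlyLE X.obj.as n)
    (f : (Qb C).obj X ⟶ (Qb C).obj Y) :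
    ∃ (Z : Kb 𝒜) (s : Z ⟶ X) (g : Z ⟶ Y), IsStrictlyLE Z.obj.as n ∧
      (kbRelAcyclic C).trW s ∧ (Qb C).map s ≫ f = (Qb C).map g := by
  obtain ⟨φ, rfl⟩ := Localization.exists_rightFraction (Qb C) (kbRelAcyclic C).trW f
  obtain ⟨Z, t, hZ, ht⟩ := exists_trW_isStrictlyLE hX φ.s φ.hs
  exact ⟨Z, t ≫ φ.s, t ≫ φ.f, hZ, MorphismProperty.comp_mem _ _ _ ht φ.hs, by simp⟩

lemma exists_trW_isStrictlyLE_comp_eq_zero {X Y : Kb 𝒜} {n : ℤ} (hX : IsStrictlyLE X.obj.as n)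
    (f : X ⟶ Y) (hf : (Qb C).map f = 0) :
    ∃ (Z : Kb 𝒜) (s : Z ⟶ X), IsStrictlyLE Z.obj.as n ∧ (kbRelAcyclic C).trW s ∧ s ≫ f = 0 := by
  rw [← (Qb C).map_zero, MorphismProperty.map_eq_iff_precomp (Qb C) (kbRelAcyclic C).trW] at hf
  obtain ⟨Z, s, hs, h⟩ := hf
  obtain ⟨Z', t, hZ', ht⟩ := exists_trW_isStrictlyLE hX s hs
  exact ⟨Z', t ≫ s, hZ', MorphismProperty.comp_mem _ _ _ ht hs, by
    rw [Category.assoc, h, comp_zero, comp_zero]⟩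

lemma toKb_obj_isStrictlyLE (M : 𝒜) : IsStrictlyLE ((toKb 𝒜).obj M).obj.as 0 :=
  inferInstanceAs (((singleFunctor 𝒜 0).obj M).IsStrictlyLE 0)

lemma IsRelQuasiIso.epi_f_zero (hC : C.IsSeparating) {K : CochainComplex 𝒜 ℤ} {M : 𝒜}
    {s : K ⟶ (singleFunctor 𝒜 0).obj M} (hs : IsRelQuasiIso C s) : Epi (s.f 0) :=
  epi_of_forall_exists_comp_eq hC _ fun c hc y ↦ by
    obtain ⟨z, w, -, h⟩ := (isRelQuasiIso_iff s).1 hs c hc (-1) 0 1 rfl rfl 0 y (by simp) (by simp)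
    exact ⟨z, by simpa using h⟩

lemma IsRelQuasiIso.exists_comp_map_single_eq (hC : C.IsSeparating) {K : CochainComplex 𝒜 ℤ}
    {M N : 𝒜} {s : K ⟶ (HomologicalComplex.single 𝒜 (.up ℤ) 0).obj M} (hs : IsRelQuasiIso C s)
    (hK : K.IsStrictlyLE 0) (g : K ⟶ (HomologicalComplex.single 𝒜 (.up ℤ) 0).obj N) :
    ∃ h : M ⟶ N, s ≫ (HomologicalComplex.single 𝒜 (.up ℤ) 0).map h = g := by
  let S := ShortComplex.mk (K.d (-1) 0) (s.f 0) (by rw [← s.comm]; simp)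
  have : Epi S.g := hs.epi_f_zero hC
  have hS : S.Exact :=
    exact_of_forall_exists_lift hC _ fun c hc y hy ↦ by
      obtain ⟨z, w, h, -⟩ := (isRelQuasiIso_iff s).1 hs c hc (-2) (-1) 0 rfl rfl y 0
        ((K.isZero_of_isStrictlyLE 0 _ (by lia)).eq_of_tgt _ _) (by simpa using hy)
      exact ⟨-z, (Preadditive.neg_comp _ _).trans (neg_eq_iff_eq_neg.2 h)⟩
  let l := hS.desc (g.f 0) (by rw [← g.comm]; simp)
  have hl : s.f 0 ≫ l = g.f 0 := hS.g_desc _ _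
  refine ⟨(HomologicalComplex.singleObjXSelf (.up ℤ) 0 M).inv ≫ l ≫
    (HomologicalComplex.singleObjXSelf (.up ℤ) 0 N).hom, HomologicalComplex.to_single_hom_ext ?_⟩
  simp [HomologicalComplex.single_map_f_self, hl]

lemma f_eq_zero_of_homotopy {K : CochainComplex 𝒜 ℤ} {n : ℤ} (hK : K.IsStrictlyLE n) {N : 𝒜}
    (g : K ⟶ (singleFunctor 𝒜 n).obj N) (H : Homotopy g 0) : g.f n = 0 := by
  have h : H.hom (n + 1) n = 0 := (K.isZero_of_isStrictlyLE n (n + 1) (by lia)).eq_of_src _ _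
  rw [H.comm n, dNext_eq H.hom (show (ComplexShape.up ℤ).Rel n (n + 1) from rfl),
    prevD_eq H.hom (show (ComplexShape.up ℤ).Rel (n - 1) n from sub_add_cancel n 1), h]
  simp

lemma full_toKb_comp_Qb (hC : C.IsSeparating) : (toKb 𝒜 ⋙ Qb C).Full where
  map_surjective {M N} f := by
    obtain ⟨Z, s, g, hZ, hs, h⟩ := exists_rightFraction_isStrictlyLE (toKb_obj_isStrictlyLE M) f
    obtain ⟨s, rfl⟩ := kbHom_surjective _ _ s
    obtain ⟨g, rfl⟩ := kbHom_surjective _ _ g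
    obtain ⟨l, hl⟩ := IsRelQuasiIso.exists_comp_map_single_eq hC ((trW_kbHom_iff s).1 hs) hZ g
    have := Localization.inverts (Qb C) (kbRelAcyclic C).trW _ hs
    refine ⟨l, (cancel_epi ((Qb C).map (kbHom _ _ s))).1 ?_⟩
    refine ((Qb C).map_comp _ _).symm.trans ((congrArg _ ?_).trans h.symm)
    exact (kbHom_comp (Y := (toKb 𝒜).obj M) (Z := (toKb 𝒜).obj N) _ _).symm.trans
      (congrArg _ hl)

lemma eq_zero_of_Qb_map_toKb_map_eq_zero (hC : C.IsSeparating) {M N : 𝒜} (f : M ⟶ N)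
    (hf : (Qb C).map ((toKb 𝒜).map f) = 0) : f = 0 := by
  obtain ⟨Z, s, hZ, hs, h⟩ := exists_trW_isStrictlyLE_comp_eq_zero (toKb_obj_isStrictlyLE M) _ hf
  obtain ⟨s, rfl⟩ := kbHom_surjective _ _ s
  have := IsRelQuasiIso.epi_f_zero hC ((trW_kbHom_iff s).1 hs)
  obtain ⟨H⟩ := homotopy_of_kbHom_eq <|
    (kbHom_comp (Y := (toKb 𝒜).obj M) (Z := (toKb 𝒜).obj N) _ _).trans
      (h.trans (kbHom_zero _ _).symm)
  have h₀ : s.f 0 ≫ ((singleFunctor 𝒜 0).map f).f 0 = 0 := f_eq_zero_of_homotopy hZ _ H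
  apply (singleFunctor 𝒜 0).map_injective
  apply HomologicalComplex.to_single_hom_ext
  rw [Functor.map_zero]
  exact this.left_cancellation _ _ (h₀.trans comp_zero.symm)

end FullyFaithful

section Vanishing

variable {𝒜 : Type u} [Category.{v} 𝒜] [Abelian 𝒜] {C : ObjectProperty 𝒜}

/-- `Q` is closed under syzygies adapted to `C`: every object of `Q` is the cokernel in a
`Hom_𝒜(C, -)`-exact sequence `0 ⟶ K ⟶ P ⟶ M ⟶ 0` with `P` in `C` and `K` in `Q` such that all
morphisms from `K` to an object of `C` extend to `P`. Both `^{⊥_C} C` and `𝒢(C)` have this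
property, which is all that the computation of the morphisms out of `M` in the
`C`-singularity category requires. -/
def IsSyzygyClosed (C Q : ObjectProperty 𝒜) : Prop :=
  ∀ ⦃M : 𝒜⦄, Q M → ∃ (K P : 𝒜) (i : K ⟶ P) (p : P ⟶ M) (w : i ≫ p = 0),
    IsRelShortExact C (ShortComplex.mk i p w) ∧ C P ∧ Q K ∧
      ∀ ⦃c : 𝒜⦄, C c → ∀ f : K ⟶ c, ∃ g : P ⟶ c, i ≫ g = f

lemma isZero_toKb_shift (c : 𝒜) {n i : ℤ} (hi : i + n ≠ 0) :
    IsZero ((((toKb 𝒜).obj c)⟦n⟧).obj.as.X i) := by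
  have e : (((toKb 𝒜).obj c)⟦n⟧).obj = (HomotopyCategory.quotient 𝒜 (.up ℤ)).obj
      ((CategoryTheory.shiftFunctor (CochainComplex 𝒜 ℤ) n).obj ((toKb 𝒜).obj c).obj.as) :=
    Eq.trans (by with_unfolding_all rfl) (HomotopyCategory.shift_quotient_obj _ n)
  rw [e]
  exact HomologicalComplex.isZero_single_obj_X (.up ℤ) 0 c (i + n) hi

lemma exists_Qb_map_eq {P Y : Kb 𝒜} (hP : kbOf C P) (f : (Qb C).obj P ⟶ (Qb C).obj Y) :
    ∃ g : P ⟶ Y, (Qb C).map g = f :=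
  ((kbOf_le_leftOrthogonal C _ hP).map_bijective_of_isTriangulated (Qb C) Y).2 f

lemma hom_shift_eq_zero_of_kbOf {P : Kb 𝒜} (hP : kbOf C P) (N : 𝒜) {n : ℤ}
    (hn : ∀ i, i + n = 0 → IsZero (P.obj.as.X i))
    (f : (Qb C).obj P ⟶ ((Qb C).obj ((toKb 𝒜).obj N))⟦n⟧) : f = 0 := by
  obtain ⟨g, hg⟩ := exists_Qb_map_eq hP (f ≫ ((Qb C).commShiftIso n).inv.app ((toKb 𝒜).obj N))
  have hg' : g = 0 := kb_hom_eq_zero (fun i ↦ or_iff_not_imp_right.2 fun hi ↦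
    hn i (of_not_not fun h ↦ hi (isZero_toKb_shift N h))) g
  rw [← cancel_mono (((Qb C).commShiftIso n).inv.app _), zero_comp, ← hg, hg', Functor.map_zero]

variable [C.IsClosedUnderFiniteProducts]

lemma kbOf_toKb {c : 𝒜} (hc : C c) : kbOf C ((toKb 𝒜).obj c) := fun n ↦ by
  by_cases hn : n = 0
  · subst hn
    exact C.prop_of_iso (HomologicalComplex.singleObjXSelf (.up ℤ) 0 c).symm hc
  · exact C.prop_of_isZero (HomologicalComplex.isZero_single_obj_X (.up ℤ) 0 c n hn)

lemma hom_shift_eq_zero_of_prop {P : 𝒜} (hP : C P) (c : 𝒜) {n : ℤ} (hn : n ≠ 0)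
    (f : (Qb C).obj ((toKb 𝒜).obj P) ⟶ ((Qb C).obj ((toKb 𝒜).obj c))⟦n⟧) : f = 0 :=
  hom_shift_eq_zero_of_kbOf (kbOf_toKb hP) c (fun i hi ↦
    HomologicalComplex.isZero_single_obj_X (.up ℤ) 0 P i (by lia)) f

theorem IsSyzygyClosed.hom_shift_eq_zero (hC : C.IsSeparating) {Q : ObjectProperty 𝒜}
    (hQ : IsSyzygyClosed C Q) {c : 𝒜} (hc : C c) (n : ℕ) {M : 𝒜} (hM : Q M)
    (f : (Qb C).obj ((toKb 𝒜).obj M) ⟶ ((Qb C).obj ((toKb 𝒜).obj c))⟦((n + 1 : ℕ) : ℤ)⟧) :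
    f = 0 := by
  obtain ⟨K, P, i, p, w, hS, hP, hK, hext⟩ := hQ hM
  obtain ⟨δ, hT⟩ := hS.exists_distinguished
  refine hom_eq_zero_of_distinguished hT
    ((CategoryTheory.shiftFunctorAdd' (Db C) (n : ℤ) 1 ((n + 1 : ℕ) : ℤ) (by simp)).app _)
    (hom_shift_eq_zero_of_prop hP c (by lia)) (fun u ↦ ?_) f
  cases n with
  | zero =>
    let e := (shiftFunctorZero (Db C) ℤ).app ((Qb C).obj ((toKb 𝒜).obj c))
    have := full_toKb_comp_Qb hC
    obtain ⟨φ, hφ⟩ := (toKb 𝒜 ⋙ Qb C).map_surjective (u ≫ e.hom)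
    obtain ⟨ψ, rfl⟩ := hext hc φ
    refine ⟨(toKb 𝒜 ⋙ Qb C).map ψ ≫ e.inv, (cancel_mono e.hom).1 ?_⟩
    rw [← hφ, Functor.map_comp]
    simp
  | succ n => exact ⟨0, by rw [hQ.hom_shift_eq_zero hC hc n hK u, comp_zero]⟩

end Vanishing

section BrutalTruncation

open CochainComplex

variable {𝒜 : Type u} [Category.{v} 𝒜] [Abelian 𝒜] {C : ObjectProperty 𝒜}
  (K : CochainComplex 𝒜 ℤ) (a : ℤ) [K.IsStrictlyGE a]

/-- The projection of a complex in degrees `≥ a` onto its component in degree `a`. Its kernel is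
the brutal truncation of the complex to the degrees `≥ a + 1`. -/
def toSingle : K ⟶ (HomologicalComplex.single 𝒜 (.up ℤ) a).obj (K.X a) :=
  HomologicalComplex.mkHomToSingle (𝟙 _) (by
    rintro i rfl
    exact (K.isZero_of_isStrictlyGE (i + 1) i (by lia)).eq_of_src _ _)

variable {K} in
lemma exists_toSingle_comp_eq {N : 𝒜} (φ : K ⟶ (HomologicalComplex.single 𝒜 (.up ℤ) a).obj N) :
    ∃ b : K.X a ⟶ N, toSingle K a ≫ (HomologicalComplex.single 𝒜 (.up ℤ) a).map b = φ := by
  refine ⟨φ.f a ≫ (HomologicalComplex.singleObjXSelf (.up ℤ) a N).hom,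
    HomologicalComplex.to_single_hom_ext ?_⟩
  rw [toSingle, HomologicalComplex.comp_f, HomologicalComplex.mkHomToSingle_f,
    HomologicalComplex.single_map_f_self]
  simp

variable {a}

lemma isIso_toSingle_f {n : ℤ} (hn : n ≤ a) : IsIso ((toSingle K a).f n) := by
  obtain hn | rfl := hn.lt_or_eq
  · exact ⟨0, (K.isZero_of_isStrictlyGE a n hn).eq_of_src _ _,
      (HomologicalComplex.isZero_single_obj_X _ _ _ _ hn.ne).eq_of_src _ _⟩
  · have : (toSingle K n).f n = (HomologicalComplex.singleObjXSelf (.up ℤ) n (K.X n)).inv :=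
      (HomologicalComplex.mkHomToSingle_f _ _).trans (Category.id_comp _)
    rw [this]
    infer_instance

variable (a)

/-- The short exact sequence of complexes `0 ⟶ K^{> a} ⟶ K ⟶ K^a[-a] ⟶ 0` given by the brutal
truncation of a complex `K` in degrees `≥ a`. -/
abbrev brutalSequence : ShortComplex (CochainComplex 𝒜 ℤ) :=
  ShortComplex.mk (kernel.ι (toSingle K a)) (toSingle K a) (kernel.condition _)

lemma brutalSequence_shortExact_eval (n : ℤ) :
    ((brutalSequence K a).map (HomologicalComplex.eval _ _ n)).ShortExact := by
  have (i : ℤ) : Epi ((toSingle K a).f i) := by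
    by_cases hi : i ≤ a
    · have := isIso_toSingle_f K hi
      infer_instance
    · exact ⟨fun _ _ _ ↦
        (HomologicalComplex.isZero_single_obj_X _ _ _ _ (by lia)).eq_of_src _ _⟩
  have : Epi (toSingle K a) := HomologicalComplex.epi_of_epi_f _ this
  have hS : (brutalSequence K a).ShortExact :=
    { exact := ShortComplex.exact_of_f_is_kernel _ (kernelIsKernel _) }
  exact hS.map_of_exact _

variable {a}

lemma isZero_kernel_toSingle_X {n : ℤ} (hn : n ≤ a) : IsZero ((kernel (toSingle K a)).X n) :=
  (brutalSequence_shortExact_eval K a n).isIso_g_iff.1 (isIso_toSingle_f K hn)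

lemma isIso_kernel_ι_toSingle_f {n : ℤ} (hn : a < n) :
    IsIso ((kernel.ι (toSingle K a)).f n) :=
  (brutalSequence_shortExact_eval K a n).isIso_f_iff.2
    (HomologicalComplex.isZero_single_obj_X (.up ℤ) a _ n hn.ne')

variable (a)

lemma nonempty_splitting_brutalSequence_eval (n : ℤ) :
    Nonempty ((brutalSequence K a).map (HomologicalComplex.eval _ _ n)).Splitting := by
  by_cases hn : n ≤ a
  · exact ⟨.ofIsZeroOfIsIso _ (isZero_kernel_toSingle_X K hn) (isIso_toSingle_f K hn)⟩
  · exact ⟨.ofIsIsoOfIsZero _ (isIso_kernel_ι_toSingle_f K (not_le.1 hn))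
      (HomologicalComplex.isZero_single_obj_X (.up ℤ) a _ n (by lia))⟩

instance : (kernel (toSingle K a)).IsStrictlyGE (a + 1) :=
  (isStrictlyGE_iff _ _).2 fun _ hi ↦ isZero_kernel_toSingle_X K (by lia)

instance (b : ℤ) [K.IsStrictlyLE b] : (kernel (toSingle K a)).IsStrictlyLE b :=
  (isStrictlyLE_iff _ _).2 fun i hi ↦ by
    by_cases h : i ≤ a
    · exact isZero_kernel_toSingle_X K h
    · have := isIso_kernel_ι_toSingle_f K (not_le.1 h)
      exact (K.isZero_of_isStrictlyLE b i hi).of_iso (asIso ((kernel.ι (toSingle K a)).f i))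

variable [C.IsClosedUnderFiniteProducts]

lemma prop_kernel_toSingle_X (hK : ∀ n, C (K.X n)) (n : ℤ) :
    C ((kernel (toSingle K a)).X n) := by
  by_cases hn : n ≤ a
  · exact C.prop_of_isZero (isZero_kernel_toSingle_X K hn)
  · have := isIso_kernel_ι_toSingle_f K (not_le.1 hn)
    exact C.prop_of_iso (asIso ((kernel.ι (toSingle K a)).f n)).symm (hK n)

end BrutalTruncation

section Factorization

open CochainComplex

variable {𝒜 : Type u} [Category.{v} 𝒜] [Abelian 𝒜] {C : ObjectProperty 𝒜}
  [C.IsClosedUnderFiniteProducts]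

lemma exists_brutalTruncation {P : Kb 𝒜} (hP : kbOf C P) {a d : ℤ} (had : d + a = 0)
    (ha : IsStrictlyGE P.obj.as a) :
    ∃ (P' : Kb 𝒜) (c : 𝒜) (ι : P' ⟶ P) (q : P ⟶ ((toKb 𝒜).obj c)⟦d⟧)
      (h : ((toKb 𝒜).obj c)⟦d⟧ ⟶ P'⟦(1 : ℤ)⟧), Triangle.mk ι q h ∈ distTriang (Kb 𝒜) ∧
        kbOf C P' ∧ IsStrictlyGE P'.obj.as (a + 1) ∧ C c := by
  let K : CochainComplex 𝒜 ℤ := P.obj.as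
  obtain ⟨-, b, -, hb⟩ := P.property
  have : K.IsStrictlyGE a := ha
  have : K.IsStrictlyLE b := hb
  let P' : Kb 𝒜 := kbMk (kernel (toSingle K a)) (a + 1) b inferInstance inferInstance
  obtain ⟨Q, q, h, hT⟩ := distinguished_cocone_triangle (kbHom P' P (kernel.ι (toSingle K a)))
  have hT' := (HomotopyCategory.distinguished_iff_iso_trianglehOfDegreewiseSplit _).2
    ⟨brutalSequence K a, fun n ↦ (nonempty_splitting_brutalSequence_eval K a n).some,
      ⟨Iso.refl _⟩⟩
  obtain ⟨e, -⟩ := exists_iso_of_distinguished hT hT'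
  let e' : Q ≅ ((toKb 𝒜).obj (K.X a))⟦d⟧ := (bounded 𝒜).fullyFaithfulι.preimageIso (e ≪≫
    (((HomotopyCategory.singleFunctors 𝒜).shiftIso d a 0 had).app (K.X a)).symm ≪≫
    (((bounded 𝒜).ι.commShiftIso d).app ((toKb 𝒜).obj (K.X a))).symm)
  exact ⟨P', K.X a, _, _, _, distinguished_of_iso₃ hT e',
    prop_kernel_toSingle_X K a hP,
    inferInstanceAs ((kernel (toSingle K a)).IsStrictlyGE (a + 1)), hP a⟩

/-- The bounded complexes with terms in `C` concentrated in degrees `≥ 0`. -/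
def nonnegOf (C : ObjectProperty 𝒜) : ObjectProperty (Kb 𝒜) :=
  fun P ↦ kbOf C P ∧ IsStrictlyGE P.obj.as 0

lemma IsSyzygyClosed.exists_factorization_of_isStrictlyGE (hC : C.IsSeparating)
    {Q : ObjectProperty 𝒜} (hQ : IsSyzygyClosed C Q) {M : 𝒜} (hM : Q M) (m : ℕ) {P : Kb 𝒜}
    (hP : kbOf C P) (hm : IsStrictlyGE P.obj.as (-m))
    (f : (Qb C).obj ((toKb 𝒜).obj M) ⟶ (Qb C).obj P) :
    ∃ (P' : Kb 𝒜) (g : (Qb C).obj ((toKb 𝒜).obj M) ⟶ (Qb C).obj P') (ι : P' ⟶ P),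
      nonnegOf C P' ∧ g ≫ (Qb C).map ι = f := by
  induction m generalizing P with
  | zero => exact ⟨P, f, 𝟙 P, ⟨hP, by simpa using hm⟩, by simp⟩
  | succ m ih =>
    obtain ⟨P₁, c, ι, q, h, hT, hP₁, hm₁, hc⟩ :=
      exists_brutalTruncation hP (d := (m + 1 : ℕ)) (by simp) hm
    have hfq : f ≫ (Qb C).map q = 0 :=
      (cancel_mono (((Qb C).commShiftIso ((m + 1 : ℕ) : ℤ)).hom.app _)).1
        ((hQ.hom_shift_eq_zero hC hc m hM _).trans zero_comp.symm)
    obtain ⟨f₁, rfl⟩ := Triangle.coyoneda_exact₂ _ ((Qb C).map_distinguished _ hT) f hfq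
    obtain ⟨P', g, ι', hP', rfl⟩ :=
      ih hP₁ (by rwa [show -((m + 1 : ℕ) : ℤ) + 1 = -m by lia] at hm₁) f₁
    exact ⟨P', g, ι' ≫ ι, hP', by rw [Functor.map_comp, ← Category.assoc]; rfl⟩

lemma IsSyzygyClosed.exists_factorization (hC : C.IsSeparating) {Q : ObjectProperty 𝒜}
    (hQ : IsSyzygyClosed C Q) {M : 𝒜} (hM : Q M) (A : Db C) (hA : dbOf C A)
    (p : (Qb C).obj ((toKb 𝒜).obj M) ⟶ A) :
    ∃ (B : Db C) (g : (Qb C).obj ((toKb 𝒜).obj M) ⟶ B) (i : B ⟶ A),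
      (nonnegOf C).strictMap (Qb C) B ∧ g ≫ i = p := by
  obtain ⟨P, hP, ⟨e⟩⟩ := hA
  obtain ⟨a, -, ha, -⟩ := P.property
  have ha' : IsStrictlyGE P.obj.as (-(a.natAbs : ℤ)) :=
    CochainComplex.isStrictlyGE_of_ge P.obj.as _ a (by lia)
  obtain ⟨P', g, ι, hP', hg⟩ :=
    hQ.exists_factorization_of_isStrictlyGE hC hM a.natAbs hP ha' (p ≫ e.inv)
  exact ⟨_, g, (Qb C).map ι ≫ e.hom, .mk _ hP', by
    rw [reassoc_of% hg, e.inv_hom_id, Category.comp_id]⟩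

end Factorization

section SingularityCategory

open CochainComplex

variable {𝒜 : Type u} [Category.{v} 𝒜] [Abelian 𝒜] {C : ObjectProperty 𝒜}

lemma hom_shift_eq_zero_of_nonnegOf {P : Kb 𝒜} (hP : nonnegOf C P) (N : 𝒜)
    (f : (Qb C).obj P ⟶ ((Qb C).obj ((toKb 𝒜).obj N))⟦(1 : ℤ)⟧) : f = 0 :=
  have := hP.2
  hom_shift_eq_zero_of_kbOf hP.1 N
    (fun i hi ↦ CochainComplex.isZero_of_isStrictlyGE P.obj.as 0 i (by lia)) f

lemma exists_factorization_through_toKb {P : Kb 𝒜} (hP : nonnegOf C P) {N : 𝒜}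
    (φ : (Qb C).obj P ⟶ (Qb C).obj ((toKb 𝒜).obj N)) :
    ∃ (c : 𝒜) (r : (Qb C).obj P ⟶ (Qb C).obj ((toKb 𝒜).obj c)) (b : c ⟶ N),
      C c ∧ r ≫ (Qb C).map ((toKb 𝒜).map b) = φ := by
  obtain ⟨ψ, rfl⟩ := exists_Qb_map_eq hP.1 φ
  obtain ⟨φ, rfl⟩ := kbHom_surjective _ _ ψ
  let K : CochainComplex 𝒜 ℤ := P.obj.as
  have : K.IsStrictlyGE 0 := hP.2
  obtain ⟨b, hb⟩ := exists_toSingle_comp_eq (K := K) 0 φ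
  refine ⟨K.X 0, (Qb C).map (kbHom P ((toKb 𝒜).obj (K.X 0)) (toSingle K 0)), b, hP.1 0, ?_⟩
  refine ((Qb C).map_comp _ _).symm.trans (congrArg _ ?_)
  exact (kbHom_comp (Y := (toKb 𝒜).obj (K.X 0)) (Z := (toKb 𝒜).obj N) _ _).symm.trans
    (congrArg _ hb)

variable [C.IsClosedUnderFiniteProducts]

lemma IsSyzygyClosed.toDsg_map_surjective (hC : C.IsSeparating) {Q : ObjectProperty 𝒜}
    (hQ : IsSyzygyClosed C Q) {M : 𝒜} (hM : Q M) (N : 𝒜) :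
    Function.Surjective ((toDsg C).map : (M ⟶ N) → _) := by
  have := full_toKb_comp_Qb hC
  have hV : (nonnegOf C).strictMap (Qb C) ≤ dbOf C :=
    ((nonnegOf C).strictMap_monotone (fun _ h ↦ h.1) _).trans ((kbOf C).strictMap_le_map _)
  exact (localization_map_surjective (Qsg C) hV (hQ.exists_factorization hC hM)
    (by rintro _ ⟨P, hP⟩; exact hom_shift_eq_zero_of_nonnegOf hP N)).comp
      (toKb 𝒜 ⋙ Qb C).map_surjective

lemma IsSyzygyClosed.mem_factoring (hC : C.IsSeparating) {Q : ObjectProperty 𝒜}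
    (hQ : IsSyzygyClosed C Q) {M : 𝒜} (hM : Q M) {N : 𝒜} (f : M ⟶ N)
    (hf : (toDsg C).map f = 0) : f ∈ factoring C M N := by
  obtain ⟨_, g, a, ⟨P, hP⟩, hga⟩ := exists_factorization_of_map_eq_map_zero (Qsg C)
    (hQ.exists_factorization hC hM) ((Qb C).map ((toKb 𝒜).map f))
    (hf.trans ((Qsg C).map_zero _ _).symm)
  obtain ⟨c, r, b, hc, rfl⟩ := exists_factorization_through_toKb hP a
  have := full_toKb_comp_Qb hC
  obtain ⟨β, hβ⟩ := (toKb 𝒜 ⋙ Qb C).map_surjective (g ≫ r)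
  refine ⟨c, β, b, hc, sub_eq_zero.1 (eq_zero_of_Qb_map_toKb_map_eq_zero hC _ ?_)⟩
  rw [Functor.map_sub, Functor.map_sub, sub_eq_zero, ← hga, ← Category.assoc, ← hβ,
    Functor.map_comp, Functor.map_comp]
  rfl

lemma isZero_toDsg_obj {c : 𝒜} (hc : C c) : IsZero ((toDsg C).obj c) := by
  have h : (dbOf C).trW (0 : (0 : Db C) ⟶ (Qb C).obj ((toKb 𝒜).obj c)) :=
    ⟨_, _, _, contractible_distinguished₁ _, (kbOf C).prop_map_obj _ (kbOf_toKb hc)⟩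
  have := Localization.inverts (Qsg C) (dbOf C).trW _ h
  exact ((Qsg C).map_isZero (isZero_zero (Db C))).of_iso (asIso ((Qsg C).map 0)).symm

lemma toDsg_map_eq_zero {M N : 𝒜} {f : M ⟶ N} (hf : f ∈ factoring C M N) :
    (toDsg C).map f = 0 := by
  obtain ⟨c, a, b, hc, rfl⟩ := hf
  rw [Functor.map_comp, (isZero_toDsg_obj hc).eq_of_tgt ((toDsg C).map a) 0, zero_comp]

instance : (toDsg C).Additive :=
  inferInstanceAs (toKb 𝒜 ⋙ Qb C ⋙ Qsg C).Additive

lemma IsSyzygyClosed.exists_addEquiv (hC : C.IsSeparating) {Q : ObjectProperty 𝒜}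
    (hQ : IsSyzygyClosed C Q) {M : 𝒜} (hM : Q M) (N : 𝒜) :
    ∃ e : (M ⟶ N) ⧸ factoring C M N ≃+ ((toDsg C).obj M ⟶ (toDsg C).obj N),
      ∀ f : M ⟶ N, e (QuotientAddGroup.mk f) = (toDsg C).map f := by
  let φ : (M ⟶ N) →+ ((toDsg C).obj M ⟶ (toDsg C).obj N) := (toDsg C).mapAddHom
  have hφ : factoring C M N = φ.ker :=
    le_antisymm (fun f hf ↦ toDsg_map_eq_zero hf) (fun f hf ↦ hQ.mem_factoring hC hM f hf)
  exact ⟨(QuotientAddGroup.quotientAddEquivOfEq hφ).trans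
    (QuotientAddGroup.quotientKerEquivOfSurjective φ (hQ.toDsg_map_surjective hC hM N)),
    fun _ ↦ rfl⟩

end SingularityCategory

section Syzygies

open CochainComplex

variable {𝒜 : Type u} [Category.{v} 𝒜] [Abelian 𝒜] {C : ObjectProperty 𝒜}
  {K : CochainComplex 𝒜 ℤ} {i j k : ℤ}

lemma isRelShortExact_kernel (hK : IsHomFromExact C K) (hij : i + 1 = j) (hjk : j + 1 = k)
    {M : 𝒜} (e : M ≅ kernel (K.d j k)) :
    IsRelShortExact C (ShortComplex.mk (kernel.ι (K.d i j))
      (kernel.lift (K.d j k) (K.d i j) (K.d_comp_d _ _ _) ≫ e.inv) (by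
        rw [← Category.assoc, ← cancel_mono e.hom, ← cancel_mono (kernel.ι (K.d j k))]
        simp)) := by
  refine IsRelShortExact.of_mono (S := ShortComplex.mk (kernel.ι (K.d i j)) _ _)
    (fun c _ x hx ↦ ⟨kernel.lift _ x ?_, kernel.lift_ι _ _ _⟩) fun c hc x ↦ ?_
  · simpa using congr($hx ≫ e.hom ≫ kernel.ι (K.d j k))
  · obtain ⟨y, hy⟩ := (exactAt_homFrom_iff c K hij hjk).1 (hK c hc j) (x ≫ e.hom ≫ kernel.ι _)
      (by simp)
    refine ⟨y, ?_⟩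
    rw [← cancel_mono e.hom, ← cancel_mono (kernel.ι (K.d j k))]
    simpa using hy

lemma epi_kernel_lift_d (hK : K.ExactAt j) (hij : i + 1 = j) (hjk : j + 1 = k) :
    Epi (kernel.lift (K.d j k) (K.d i j) (K.d_comp_d _ _ _)) := by
  rwa [HomologicalComplex.exactAt_iff' _ i j k (ComplexShape.prev_eq' _ hij)
    (ComplexShape.next_eq' _ hjk), ShortComplex.exact_iff_epi_kernel_lift] at hK

lemma exists_kernel_ι_comp_eq (hK : K.ExactAt j) (hij : i + 1 = j) (hjk : j + 1 = k) {c : 𝒜}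
    (hc : (homTo K c).ExactAt i) (f : kernel (K.d j k) ⟶ c) :
    ∃ g : K.X j ⟶ c, kernel.ι (K.d j k) ≫ g = f := by
  let p := kernel.lift (K.d j k) (K.d i j) (K.d_comp_d _ _ _)
  have hp : p ≫ kernel.ι (K.d j k) = K.d i j := kernel.lift_ι _ _ _
  have : Epi p := epi_kernel_lift_d hK hij hjk
  have hdp : K.d (i - 1) i ≫ p = 0 := by
    rw [← cancel_mono (kernel.ι (K.d j k)), Category.assoc, hp, K.d_comp_d, zero_comp]
  obtain ⟨g, hg⟩ := (exactAt_homTo_iff K c (sub_add_cancel i 1) hij).1 hc (p ≫ f)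
    (by rw [reassoc_of% hdp, zero_comp])
  exact ⟨g, by rw [← cancel_epi p, ← Category.assoc, hp, hg]⟩

lemma isSyzygyClosed_kernel (hC : C.IsSeparating) (hK : IsHomFromExact C K) (m : ℤ)
    (hmem : ∀ n < m, C (K.X n))
    (hext : ∀ c : 𝒜, C c → ∀ n : ℤ, n + 1 < m → (homTo K c).ExactAt n) :
    IsSyzygyClosed C (fun M ↦ ∃ n ≤ m, Nonempty (M ≅ kernel (K.d n (n + 1)))) := by
  rintro M ⟨n, hn, ⟨e⟩⟩
  obtain ⟨i, rfl⟩ : ∃ i, i + 1 = n := ⟨n - 1, sub_add_cancel n 1⟩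
  exact ⟨_, _, _, _, _, isRelShortExact_kernel hK rfl rfl e, hmem i (by lia),
    ⟨i, by lia, ⟨Iso.refl _⟩⟩, fun c hc f ↦ exists_kernel_ι_comp_eq (hK.acyclic hC i)
      (sub_add_cancel i 1) rfl (hext c hc (i - 1) (by lia)) f⟩

lemma exactAt_homTo_mappingCone {L : CochainComplex 𝒜 ℤ} (f : K ⟶ L) (hij : i + 1 = j)
    (hi : IsZero (L.X i)) {c : 𝒜} (hc : (homTo K c).ExactAt j) :
    (homTo (mappingCone f) c).ExactAt i := by
  refine (exactAt_homTo_iff _ c (sub_add_cancel i 1) hij).2 fun x hx ↦ ?_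
  obtain ⟨y, hy⟩ := (exactAt_homTo_iff K c hij rfl).1 hc ((mappingCone.inl f).v j i (by lia) ≫ x)
    (by
      have := congr((mappingCone.inl f).v i (i - 1) (by lia) ≫ $hx)
      rw [← Category.assoc, mappingCone.inl_v_d f i (i - 1) j (by lia) (by lia),
        hi.eq_of_tgt (f.f i) 0] at this
      simpa using this)
  refine ⟨-(mappingCone.fst f).1.v j (j + 1) rfl ≫ y, ?_⟩
  rw [mappingCone.ext_from_iff _ j i hij]
  refine ⟨?_, hi.eq_of_src _ _⟩
  rw [Preadditive.comp_neg, ← Category.assoc, mappingCone.d_fst_v f i j (j + 1) hij rfl]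
  simp [hy]

lemma nonempty_iso_kernel_mappingCone {M : 𝒜}
    (f : K ⟶ (HomologicalComplex.single 𝒜 (.up ℤ) 0).obj M) (hK : K.IsStrictlyLE 0) :
    Nonempty (M ≅ kernel ((mappingCone f).d 0 (0 + 1))) := by
  have hK₁ : IsZero (K.X 1) := K.isZero_of_isStrictlyLE 0 1 (by lia)
  have h₁ : IsZero ((mappingCone f).X (0 + 1)) := (mappingCone.isZero_X_iff _ _).2
    ⟨K.isZero_of_isStrictlyLE 0 _ (by lia),
      HomologicalComplex.isZero_single_obj_X _ _ _ _ (by lia)⟩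
  have hinr : (mappingCone.inr f).f 0 ≫ (mappingCone.snd f).v 0 0 (add_zero 0) = 𝟙 _ := by simp
  have hsnd : (mappingCone.snd f).v 0 0 (add_zero 0) ≫ (mappingCone.inr f).f 0 = 𝟙 _ := by
    have := mappingCone.id_X f 0 1 rfl
    rwa [hK₁.eq_of_tgt ((mappingCone.fst f).1.v 0 1 rfl) 0, zero_comp, zero_add] at this
  have : IsIso (kernel.ι ((mappingCone f).d 0 (0 + 1))) := by
    rw [h₁.eq_of_tgt ((mappingCone f).d 0 (0 + 1)) 0]
    infer_instance
  exact ⟨(HomologicalComplex.singleObjXSelf (.up ℤ) 0 M).symm ≪≫ ⟨_, _, hinr, hsnd⟩ ≪≫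
    (asIso (kernel.ι ((mappingCone f).d 0 (0 + 1)))).symm⟩

variable [C.IsClosedUnderFiniteProducts]

lemma prop_mappingCone_X {L : CochainComplex 𝒜 ℤ} (f : K ⟶ L) (n : ℤ) (hK : C (K.X (n + 1)))
    (hL : C (L.X n)) : C ((mappingCone f).X n) :=
  C.prop_of_iso (HomologicalComplex.homotopyCofiber.XIsoBiprod f n (n + 1) rfl).symm
    (prop_biprod C hK hL)

lemma leftPerp.exists_isSyzygyClosed (hC : C.IsSeparating) {M : 𝒜} (hM : leftPerp C M) :
    ∃ Q : ObjectProperty 𝒜, IsSyzygyClosed C Q ∧ Q M := by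
  obtain ⟨R, hR⟩ := hM
  have hM₀ (n : ℤ) (hn : n < 0) : IsZero (((CochainComplex.singleFunctor 𝒜 0).obj M).X n) :=
    HomologicalComplex.isZero_single_obj_X _ _ _ _ hn.ne
  refine ⟨_, isSyzygyClosed_kernel hC
    ((isHomFromExact_mappingCone_iff_isRelQuasiIso R.π).2 R.isRelQuasiIso) 0
    (fun n hn ↦ prop_mappingCone_X _ n (R.mem _) (C.prop_of_isZero (hM₀ n hn)))
    (fun c hc n hn ↦ ?_), 0, le_rfl, nonempty_iso_kernel_mappingCone R.π R.isStrictlyLE⟩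
  refine exactAt_homTo_mappingCone R.π rfl (hM₀ n (by lia)) ?_
  have hExt := (HomologicalComplex.exactAt_iff_isZero_homology _ _).2 (hR c hc (-(n + 1)) (by lia))
  rwa [neg_neg] at hExt

lemma IsSyzygyClosed.exists_comp_eq (hC : C.IsSeparating) {Q : ObjectProperty 𝒜}
    (hQ : IsSyzygyClosed C Q) {S : ShortComplex 𝒜} (hS : IsRelShortExact C S) (hX₃ : Q S.X₃)
    {c : 𝒜} (hc : C c) (f : S.X₁ ⟶ c) : ∃ g : S.X₂ ⟶ c, S.f ≫ g = f := by
  obtain ⟨δ, hT⟩ := hS.exists_distinguished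
  obtain ⟨v, hv⟩ := exists_extension_of_distinguished hT ((Qb C).map ((toKb 𝒜).map f))
    (hQ.hom_shift_eq_zero hC hc 0 hX₃ _)
  have := full_toKb_comp_Qb hC
  obtain ⟨g, rfl⟩ := (toKb 𝒜 ⋙ Qb C).map_surjective v
  refine ⟨g, sub_eq_zero.1 (eq_zero_of_Qb_map_toKb_map_eq_zero hC _ ?_)⟩
  rw [Functor.map_sub, Functor.map_sub, sub_eq_zero, ← hv]
  exact (toKb 𝒜 ⋙ Qb C).map_comp _ _

end Syzygies

section Gorenstein

open CochainComplex

variable {𝒜 : Type u} [Category.{v} 𝒜] [Abelian 𝒜] {C : ObjectProperty 𝒜}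

/-- The complex `K` with its degrees translated by `n`. Unlike in the shift `K⟦n⟧`, the signs of
the differentials are unchanged, so that their kernels are those of `K` on the nose. -/
@[simps]
def translate (K : CochainComplex 𝒜 ℤ) (n : ℤ) : CochainComplex 𝒜 ℤ where
  X i := K.X (i + n)
  d i j := K.d (i + n) (j + n)
  shape i j hij := K.shape _ _ fun h ↦ hij (by simp only [ComplexShape.up_Rel] at h ⊢; lia)

lemma IsHomFromExact.translate {K : CochainComplex 𝒜 ℤ} (hK : IsHomFromExact C K) (n : ℤ) :
    IsHomFromExact C (translate K n) := fun c hc j ↦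
  (exactAt_homFrom_iff c (RelSing.translate K n) (sub_add_cancel j 1) rfl).2
    ((exactAt_homFrom_iff c K (by lia) (by lia)).1 (hK c hc (j + n)))

lemma IsHomToExact.translate {K : CochainComplex 𝒜 ℤ} (hK : IsHomToExact C K) (n : ℤ) :
    IsHomToExact C (translate K n) := fun c hc j ↦
  (exactAt_homTo_iff (RelSing.translate K n) c (sub_add_cancel j 1) rfl).2
    ((exactAt_homTo_iff K c (by lia) (by lia)).1 (hK c hc (j + n)))

lemma nonempty_image_iso_kernel {K : CochainComplex 𝒜 ℤ} {i j k : ℤ} (hK : K.ExactAt j)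
    (hij : i + 1 = j) (hjk : j + 1 = k) : Nonempty (image (K.d i j) ≅ kernel (K.d j k)) := by
  have := epi_kernel_lift_d hK hij hjk
  have := strongEpi_of_epi (kernel.lift (K.d j k) (K.d i j) (K.d_comp_d _ _ _))
  exact ⟨(image.isoStrongEpiMono _ (kernel.ι (K.d j k)) (kernel.lift_ι _ _ _)).symm⟩

lemma gorenstein_iff (hC : C.IsSeparating) (M : 𝒜) :
    gorenstein C M ↔ ∃ K : CochainComplex 𝒜 ℤ, (∀ n : ℤ, C (K.X n)) ∧
      IsHomFromExact C K ∧ IsHomToExact C K ∧ Nonempty (M ≅ kernel (K.d 0 1)) := by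
  constructor
  · rintro ⟨K, hK, hac, hfrom, hto, ⟨e⟩⟩
    obtain ⟨e'⟩ := nonempty_image_iso_kernel (hac 0) (neg_add_cancel 1) (zero_add 1)
    exact ⟨K, hK, hfrom, hto, ⟨e ≪≫ e'⟩⟩
  · rintro ⟨K, hK, hfrom, hto, ⟨e⟩⟩
    have hac := hfrom.acyclic hC
    obtain ⟨e'⟩ := nonempty_image_iso_kernel (hac 0) (neg_add_cancel 1) (zero_add 1)
    exact ⟨K, hK, hac, hfrom, hto, ⟨e ≪≫ e'.symm⟩⟩

lemma isSyzygyClosed_gorenstein (hC : C.IsSeparating) : IsSyzygyClosed C (gorenstein C) := by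
  intro M hM
  obtain ⟨K, hK, hfrom, hto, ⟨e⟩⟩ := (gorenstein_iff hC M).1 hM
  have hker : gorenstein C (kernel (K.d (-1) 0)) := (gorenstein_iff hC _).2
    ⟨translate K (-1), fun n ↦ hK _, hfrom.translate (-1), hto.translate (-1), ⟨Iso.refl _⟩⟩
  exact ⟨_, _, _, _, _, isRelShortExact_kernel hfrom (neg_add_cancel 1) (zero_add 1) e,
    hK (-1), hker, fun c hc f ↦ exists_kernel_ι_comp_eq (hfrom.acyclic hC (-1))
      (sub_add_cancel (-1) 1) (neg_add_cancel 1) (hto c hc (-1 - 1)) f⟩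

lemma isConflationProjective_of_prop {P : (gorenstein C).FullSubcategory} (hP : C P.obj) :
    IsConflationProjective C P := by
  intro S hS f
  obtain ⟨g, hg⟩ := IsRelShortExact.exists_comp_eq hS hP f.hom
  exact ⟨(gorenstein C).homMk g, by ext; exact hg⟩

variable [C.IsClosedUnderFiniteProducts]

lemma gorenstein_of_prop (hC : C.IsSeparating) {c : 𝒜} (hc : C c) : gorenstein C c := by
  let K := (HomologicalComplex.single 𝒜 (.up ℤ) 0).obj c
  have hid : IsRelQuasiIso C (𝟙 K) := fun _ _ ↦ inferInstance
  exact (gorenstein_iff hC c).2 ⟨mappingCone (𝟙 K),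
    fun n ↦ prop_mappingCone_X _ n (kbOf_toKb hc _) (kbOf_toKb hc _),
    (isHomFromExact_mappingCone_iff_isRelQuasiIso _).2 hid,
    isHomToExact_of_homotopy (mappingCone.homotopyToZeroOfId K),
    nonempty_iso_kernel_mappingCone (𝟙 K) inferInstance⟩

lemma IsConflationProjective.exists_retraction (hC : C.IsSeparating)
    {P : (gorenstein C).FullSubcategory} (hP : IsConflationProjective C P) :
    ∃ (c : 𝒜) (s : P.obj ⟶ c) (r : c ⟶ P.obj), C c ∧ s ≫ r = 𝟙 P.obj := by
  obtain ⟨K, c, i, p, w, hS, hc, hK, -⟩ := isSyzygyClosed_gorenstein hC P.property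
  let S : ShortComplex (gorenstein C).FullSubcategory :=
    ShortComplex.mk (X₁ := ⟨K, hK⟩) (X₂ := ⟨c, gorenstein_of_prop hC hc⟩) (X₃ := P)
      ((gorenstein C).homMk i) ((gorenstein C).homMk p) (by ext; exact w)
  obtain ⟨g, hg⟩ := hP S hS (𝟙 P)
  exact ⟨c, g.hom, p, hc, congr(($hg).hom)⟩

lemma isConflationInjective_of_prop (hC : C.IsSeparating) {I : (gorenstein C).FullSubcategory}
    (hI : C I.obj) : IsConflationInjective C I := by
  intro S hS f
  obtain ⟨g, hg⟩ := (isSyzygyClosed_gorenstein hC).exists_comp_eq hC (S := S.map (gorenstein C).ι)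
    hS S.X₃.property hI f.hom
  exact ⟨(gorenstein C).homMk g, by ext; exact hg⟩

lemma stableRel_iff_sub_mem_factoring (hC : C.IsSeparating)
    {X Y : (gorenstein C).FullSubcategory} (f g : X ⟶ Y) :
    stableRel C f g ↔ f.hom - g.hom ∈ factoring C X.obj Y.obj := by
  constructor
  · rintro ⟨P, a, b, hP, -, hab⟩
    obtain ⟨c, s, r, hc, hsr⟩ := hP.exists_retraction hC
    refine ⟨c, a.hom ≫ s, r ≫ b.hom, hc, ?_⟩
    rw [Category.assoc, reassoc_of% hsr]
    exact congr(($hab).hom).symm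
  · rintro ⟨c, a, b, hc, hab⟩
    let P : (gorenstein C).FullSubcategory := ⟨c, gorenstein_of_prop hC hc⟩
    refine ⟨P, (gorenstein C).homMk a, (gorenstein C).homMk b,
      isConflationProjective_of_prop hc, isConflationInjective_of_prop hC hc, ?_⟩
    ext
    exact hab.symm

lemma stableRel_iff_theta_map_eq (hC : C.IsSeparating) {X Y : (gorenstein C).FullSubcategory}
    (f g : X ⟶ Y) : stableRel C f g ↔ (theta C).map f = (theta C).map g := by
  rw [stableRel_iff_sub_mem_factoring hC, ← sub_eq_zero (a := (theta C).map f)]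
  refine Iff.trans ⟨toDsg_map_eq_zero,
    (isSyzygyClosed_gorenstein hC).mem_factoring hC X.property _⟩ ?_
  rw [Functor.map_sub]
  rfl

theorem exists_stable_functor (hC : C.IsSeparating) :
    ∃ θ' : StableGorenstein C ⥤ Dsg C, toStable C ⋙ θ' = theta C ∧ θ'.Full ∧ θ'.Faithful := by
  let θ' : StableGorenstein C ⥤ Dsg C := CategoryTheory.Quotient.lift (stableRel C) (theta C)
    fun _ _ f g ↦ (stableRel_iff_theta_map_eq hC f g).1
  refine ⟨θ', CategoryTheory.Quotient.lift_spec _ _ _, ⟨fun {X Y} f ↦ ?_⟩, ⟨fun {X Y} f g h ↦ ?_⟩⟩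
  · obtain ⟨g, hg⟩ := (isSyzygyClosed_gorenstein hC).toDsg_map_surjective hC
      X.as.property Y.as.obj f
    exact ⟨(toStable C).map ((gorenstein C).homMk g), hg⟩
  · obtain ⟨f, rfl⟩ := (toStable C).map_surjective (X := X.as) (Y := Y.as) f
    obtain ⟨g, rfl⟩ := (toStable C).map_surjective (X := X.as) (Y := Y.as) g
    exact CategoryTheory.Quotient.sound _ ((stableRel_iff_theta_map_eq hC f g).2 h)

end Gorenstein

end RelSing

end

theorem proposition4p9_general {𝒜 : Type u} [Category.{v} 𝒜] [Abelian 𝒜] (C : ObjectProperty 𝒜)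
    [C.IsClosedUnderFiniteProducts] (hC : C.IsSeparating) :
    (∀ M N : 𝒜, RelSing.leftPerp C M →
      ∃ e : (M ⟶ N) ⧸ RelSing.factoring C M N ≃+
          ((RelSing.toDsg C).obj M ⟶ (RelSing.toDsg C).obj N),
        ∀ f : M ⟶ N, e (QuotientAddGroup.mk f) = (RelSing.toDsg C).map f) ∧
    ∃ θ' : RelSing.StableGorenstein C ⥤ RelSing.Dsg C,
      RelSing.toStable C ⋙ θ' = RelSing.theta C ∧ θ'.Full ∧ θ'.Faithful := by
  refine ⟨fun M N hM ↦ ?_, RelSing.exists_stable_functor hC⟩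
  obtain ⟨Q, hQ, hQM⟩ := RelSing.leftPerp.exists_isSyzygyClosed hC hM
  exact hQ.exists_addEquiv hC hQM N

theorem proposition4p9 (k : Type w) [Field k] (A : Type u) [Ring A] [Algebra k A]
    [Module.Finite k A] :
    haveI : IsNoetherianRing A := IsNoetherianRing.of_finite k A
    ∀ (C : ObjectProperty (FGModuleCat.{u} A)) [C.IsClosedUnderFiniteProducts]
      [C.IsStableUnderRetracts], RelSing.IsAdmissible C →
      (∀ M N : FGModuleCat.{u} A, RelSing.leftPerp C M →
        ∃ e : (M ⟶ N) ⧸ RelSing.factoring C M N ≃+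
            ((RelSing.toDsg C).obj M ⟶ (RelSing.toDsg C).obj N),
          ∀ f : M ⟶ N, e (QuotientAddGroup.mk f) = (RelSing.toDsg C).map f) ∧
      ∃ θ' : RelSing.StableGorenstein C ⥤ RelSing.Dsg C,
        RelSing.toStable C ⋙ θ' = RelSing.theta C ∧ θ'.Full ∧ θ'.Faithful := by
  intro C _ _ hC
  have : IsNoetherianRing A := IsNoetherianRing.of_finite k A
  exact proposition4p9_general C hC.isSeparating
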